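/- Let $\tau\in\mathbb{C}$ be an imaginary quadratic algebraic integer, i.e. a root of $X^2-pX+q$ with $p,q\in\mathbb{Z}$ and $4q-p^2>0$. Assume $|\tau|>1$, and let $w\ge 2$ be an integer. Let $\lambda$ denote the Lebesgue measure on $\mathbb{C}$. Let $V=\{z\in\mathbb{C} : |z|\le|z-y| \text{ for all } y\in\mathbb{Z}[\tau]\}$ be the Voronoi cell of $0$, and let $\widetilde V$ be a restricted Voronoi cell, that is, any subset $\widetilde V\subseteq V$ such that every $z\in\mathbb{C}$ can be written in exactly one way as $z=u+v$ with $u\in\mathbb{Z}[\tau]$ and $v\in\widetilde V$; in this case put $\{z\}_{\mathbb{Z}[\tau]}:=v$. Let $\mathcal{D}$ be the corresponding digit set of minimal norm representatives modulo $\tau^w$: it consists of $0$ and of all $\eta\in\mathbb{Z}[\tau]\cap\tau^w\widetilde V$ that are not divisible by $\tau$ in $\mathbb{Z}[\tau]$. Let $\mathbf{NAF}$ be the set of all sequences $\xi=(\xi_j)_{j\in\mathbb{Z}}\in\mathcal{D}^{\mathbb{Z}}$ with $\xi_j=0$ for all $j\ge 0$ such that each block $\xi_{j+w-1}\ldots\xi_j$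 of $w$ consecutive digits contains at most one nonzero digit, and write $\mathrm{value}(\xi)=\sum_{j\in\mathbb{Z}}\xi_j\tau^j$. Define the fundamental domain $$\mathcal{F}=\{\mathrm{value}(\xi) : \xi\in\mathbf{NAF}\}$$ and, for $0\ne\eta\in\mathcal{D}$, the characteristic set $$W_\eta=\bigl\{\,\{\mathrm{value}(\xi)\}_{\mathbb{Z}[\tau]} : \xi\in\mathbf{NAF},\ \xi_{-w}=\eta\bigr\}.$$ Put $$e_w=\frac{1}{|\tau|^{2(w-1)}\bigl((|\tau|^2-1)w+1\bigr)}.$$ Then $\lambda(W_\eta)=e_w\,\lambda(V)$ for every nonzero $\eta\in\mathcal{D}$, and $$\lambda(\mathcal{F})=|\tau|^{2(2w-1)}\,e_w\,\lambda(V)=\frac{|\tau|^{2w}\,|\operatorname{Im}\tau|}{(|\tau|^2-1)w+1}.$$ -/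

import Mathlib

open MeasureTheory

noncomputable section

namespace WNAF

/-- The lattice `ℤ[τ]`, as a subset of the complex plane. -/
def lattice (τ : ℂ) : Set ℂ := (Algebra.adjoin ℤ {τ} : Subalgebra ℤ ℂ)

/-- The (closed) Voronoi cell `V` for `0` corresponding to the lattice `ℤ[τ]`. -/
def voronoiCell (τ : ℂ) : Set ℂ := {z | ∀ y ∈ lattice τ, ‖z‖ ≤ ‖z - y‖}

/-- `Vr` is a restricted Voronoi cell: it arises from `V` by keeping only a part of the boundary,
in such a way that the translates `u + Vr`, `u ∈ ℤ[τ]`, partition the complex plane. (Points in the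
interior of `V` have to belong to `Vr`, since they belong to no other translate of `V`.) -/
structure IsRestrictedVoronoiCell (τ : ℂ) (Vr : Set ℂ) : Prop where
  subset : Vr ⊆ voronoiCell τ
  existsUnique : ∀ z : ℂ, ∃! u : ℂ, u ∈ lattice τ ∧ z - u ∈ Vr

/-- The image of `A` under the fractional part with respect to `ℤ[τ]`, which sends `u + v` with
`u ∈ ℤ[τ]` and `v ∈ Vr` to `v`. -/
def fracPartImage (τ : ℂ) (Vr A : Set ℂ) : Set ℂ :=
  {v | v ∈ Vr ∧ ∃ u ∈ lattice τ, u + v ∈ A}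

/-- The minimal norm representatives digit set modulo `τ ^ w`: it consists of `0` and of those
elements of `ℤ[τ]` that are not divisible by `τ` in `ℤ[τ]` and lie in `τ ^ w • Vr`. -/
def digitSet (τ : ℂ) (w : ℕ) (Vr : Set ℂ) : Set ℂ :=
  {0} ∪ {η | η ∈ lattice τ ∧ (¬ ∃ y ∈ lattice τ, η = τ * y) ∧ ∃ v ∈ Vr, η = τ ^ w * v}

/-- Width-`w` non-adjacent forms with digits in `D`: each block of `w` consecutive digits contains
at most one nonzero digit. -/
def IsWNAF (D : Set ℂ) (w : ℕ) (ξ : ℤ → ℂ) : Prop :=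
  (∀ j : ℤ, ξ j ∈ D) ∧
    ∀ j : ℤ, {k : ℤ | j ≤ k ∧ k < j + (w : ℤ) ∧ ξ k ≠ 0}.Subsingleton

/-- The non-adjacent forms whose digits left of the `τ`-point (indices `≥ 0`) all vanish, with
arbitrarily many digits right of the `τ`-point. -/
def fractionalNAFs (D : Set ℂ) (w : ℕ) : Set (ℤ → ℂ) :=
  {ξ | IsWNAF D w ξ ∧ ∀ j : ℤ, 0 ≤ j → ξ j = 0}

/-- The value `∑ ξ_j τ^j` of a digit sequence. (For `‖τ‖ > 1` and bounded digits that vanish at all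
indices `≥ 0`, the series converges absolutely.) -/
def value (τ : ℂ) (ξ : ℤ → ℂ) : ℂ := ∑' j : ℤ, ξ j * τ ^ j

/-- The fundamental domain. -/
def fundamentalDomain (τ : ℂ) (w : ℕ) (Vr : Set ℂ) : Set ℂ :=
  value τ '' fractionalNAFs (digitSet τ w Vr) w

/-- The values of all fractional non-adjacent forms with digit `η` at index `-w`. -/
def digitValues (τ : ℂ) (w : ℕ) (Vr : Set ℂ) (η : ℂ) : Set ℂ :=
  value τ '' {ξ | ξ ∈ fractionalNAFs (digitSet τ w Vr) w ∧ ξ (-(w : ℤ)) = η}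

/-- The characteristic set `W_η` of the digit `η`. -/
def characteristicSet (τ : ℂ) (w : ℕ) (Vr : Set ℂ) (η : ℂ) : Set ℂ :=
  fracPartImage τ Vr (digitValues τ w Vr η)

/-- The constant `e_w`, where the norm of `τ` is `‖τ‖ ^ 2`. -/
def digitDensity (τ : ℂ) (w : ℕ) : ℝ :=
  1 / ((‖τ‖ ^ 2) ^ (w - 1) * ((‖τ‖ ^ 2 - 1) * (w : ℝ) + 1))

end WNAF

end

/-!
# Tilings of the plane by values of width-`w` non-adjacent forms

Write `L = ℤ[τ]`, `d = |τ| ^ 2`, and let `F` be the fundamental domain. Grouping the non-adjacent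
forms by their first digit shows that `τ F` is the union of `F` and of the sets
`η + τ ^ (-(w - 1)) F`, where `η` runs over the `d ^ w - d ^ (w - 1)` nonzero digits
(`similarCopy_fundamentalDomain`). The measures of these parts add up to exactly `d λ(F) = λ(τ F)`,
so the parts do not overlap (`aedisjoint_digitPiece`).

To a lattice point `x` belongs the tile `x + τ ^ (-e) F`, where `e` is the number of zeros which have
to follow the non-adjacent form of `x`; it is the least `e` such that `τ ^ (w - 1)` divides
`τ ^ e x`. Every `x` arises from its `predecessor` by appending one digit, and the tile of `x` is one
of the parts of `τ` times the tile of the predecessor.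

* The tiles do not overlap (`aedisjoint_tile`): every lattice point has a finite non-adjacent form,
  i.e. iterating `predecessor` leads to `0`, so two given tiles are different parts of `τ ^ n F` for
  some `n`.
* The tiles cover the plane (`exists_mem_tile`): their union is closed, invariant under division by
  `τ`, and contains `L`, hence also the dense set of all `τ ^ (-n) u` with `u ∈ L`.

The existence of finite non-adjacent forms (`exists_iterate_predecessor_eq_zero`) is a descent. If
`τ ^ (-w) x = u + v` with `u ∈ L` and `v` in the Voronoi cell, then `|v| ≤ |τ ^ (-w) x|` because
`-u` is a lattice point, so that `|u| ≤ 2 |τ| ^ (-w) |x|`. This is less than `|x|` unless `d = 2`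
and `w = 2`. In this exceptional case equality forces `u = (2 / τ ^ 2) x`, and the three
possible values of the square of the trace of `τ` exclude that it persists.

The tiles are permuted by the translations by `τ ^ (w - 1) L`, so the tiles of a system of residues
modulo `τ ^ (w - 1)` together have measure `d ^ (w - 1) λ(V)` (`sum_volume_residues`). On the other
hand, their measures add up to `λ(F)` times a sum which is computed by counting the residues that are
divisible by a given power of `τ` (`sum_inv_pow_divisionDepth`). This gives `λ(F)`. Finally, the
values of the forms with digit `η` at index `-w` form the set `τ ^ (-w) T`, `T` the tile of `η`. Its
translates by lattice points do not overlap since they are scaled tiles as well, so passing to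
fractional parts preserves its measure (`volume_fracPartImage`).
-/

namespace WNAF

open scoped ENNReal Pointwise

/-! ### The lattice -/

/-- `τ` is a non-real quadratic integer, with characteristic polynomial `X ^ 2 - p X + q`, outside
the closed unit disc. -/
structure IsImaginaryQuadraticBase (τ : ℂ) (p q : ℤ) : Prop where
  root : τ ^ 2 - (p : ℂ) * τ + (q : ℂ) = 0
  disc : 0 < 4 * q - p ^ 2
  one_lt_norm : 1 < ‖τ‖

section Lattice

variable {τ : ℂ} {p q : ℤ}

theorem zero_mem_lattice : (0 : ℂ) ∈ lattice τ := (Algebra.adjoin ℤ {τ}).zero_mem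

theorem self_mem_lattice : τ ∈ lattice τ := Algebra.subset_adjoin (Set.mem_singleton τ)

theorem add_mem_lattice {x y : ℂ} (hx : x ∈ lattice τ) (hy : y ∈ lattice τ) :
    x + y ∈ lattice τ := (Algebra.adjoin ℤ {τ}).add_mem hx hy

theorem sub_mem_lattice {x y : ℂ} (hx : x ∈ lattice τ) (hy : y ∈ lattice τ) :
    x - y ∈ lattice τ := (Algebra.adjoin ℤ {τ}).sub_mem hx hy

theorem neg_mem_lattice {x : ℂ} (hx : x ∈ lattice τ) : -x ∈ lattice τ :=
  (Algebra.adjoin ℤ {τ}).neg_mem hx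

theorem mul_mem_lattice {x y : ℂ} (hx : x ∈ lattice τ) (hy : y ∈ lattice τ) :
    x * y ∈ lattice τ := (Algebra.adjoin ℤ {τ}).mul_mem hx hy

theorem intCast_mem_lattice (n : ℤ) : (n : ℂ) ∈ lattice τ := by
  exact (Algebra.adjoin ℤ {τ}).intCast_mem n

theorem pow_mem_lattice (n : ℕ) : τ ^ n ∈ lattice τ :=
  (Algebra.adjoin ℤ {τ}).pow_mem self_mem_lattice n

theorem pow_mul_mem_lattice (n : ℕ) {x : ℂ} (hx : x ∈ lattice τ) : τ ^ n * x ∈ lattice τ :=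
  mul_mem_lattice (pow_mem_lattice n) hx

namespace IsImaginaryQuadraticBase

theorem ne_zero (h : IsImaginaryQuadraticBase τ p q) : τ ≠ 0 := by
  rintro rfl
  have := h.one_lt_norm
  norm_num at this

theorem re_im (h : IsImaginaryQuadraticBase τ p q) :
    τ.im ≠ 0 ∧ 2 * τ.re = p ∧ τ.re ^ 2 + τ.im ^ 2 = q := by
  have hr := congrArg Complex.re h.root
  have hi := congrArg Complex.im h.root
  simp [pow_two] at hr hi
  have hd : (0 : ℝ) < 4 * q - p ^ 2 := by exact_mod_cast h.disc
  have him : τ.im ≠ 0 := by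
    intro h0
    rw [h0] at hr
    nlinarith [sq_nonneg (2 * τ.re - p)]
  have hre : 2 * τ.re = p := by
    have : τ.im * (2 * τ.re - p) = 0 := by linarith
    rcases mul_eq_zero.1 this with h1 | h1
    · exact absurd h1 him
    · linarith
  refine ⟨him, hre, ?_⟩
  rw [← hre] at hr
  nlinarith

theorem norm_sq (h : IsImaginaryQuadraticBase τ p q) : ‖τ‖ ^ 2 = q := by
  rw [Complex.sq_norm, Complex.normSq_apply, ← h.re_im.2.2]
  ring

theorem mem_lattice_iff (h : IsImaginaryQuadraticBase τ p q) {z : ℂ} :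
    z ∈ lattice τ ↔ ∃ a b : ℤ, z = a + b * τ := by
  constructor
  · intro hz
    refine Algebra.adjoin_induction (p := fun z _ => ∃ a b : ℤ, z = a + b * τ)
      ?_ ?_ ?_ ?_ hz
    · rintro x hx
      rw [Set.mem_singleton_iff] at hx
      exact ⟨0, 1, by simp [hx]⟩
    · intro r
      exact ⟨r, 0, by simp⟩
    · rintro x y - - ⟨a, b, rfl⟩ ⟨c, d, rfl⟩
      exact ⟨a + c, b + d, by push_cast; ring⟩
    · rintro x y - - ⟨a, b, rfl⟩ ⟨c, d, rfl⟩
      refine ⟨a * c - b * d * q, a * d + b * c + b * d * p, ?_⟩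
      push_cast
      linear_combination (b * d : ℂ) * h.root
  · rintro ⟨a, b, rfl⟩
    exact add_mem_lattice (intCast_mem_lattice a)
      (mul_mem_lattice (intCast_mem_lattice b) self_mem_lattice)

theorem countable_lattice (h : IsImaginaryQuadraticBase τ p q) : (lattice τ).Countable := by
  refine (Set.countable_range fun ab : ℤ × ℤ => (ab.1 + ab.2 * τ : ℂ)).mono fun z hz => ?_
  obtain ⟨a, b, rfl⟩ := h.mem_lattice_iff.1 hz
  exact ⟨(a, b), rfl⟩

theorem finite_lattice_norm_le (h : IsImaginaryQuadraticBase τ p q) (C : ℝ) :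
    {z | z ∈ lattice τ ∧ ‖z‖ ≤ C}.Finite := by
  set B := ⌈C / |τ.im|⌉
  set A := ⌈C + B * ‖τ‖⌉
  have him : 0 < |τ.im| := abs_pos.2 h.re_im.1
  refine (((Set.finite_Icc (-A) A).prod (Set.finite_Icc (-B) B)).image
    fun ab : ℤ × ℤ => (ab.1 + ab.2 * τ : ℂ)).subset ?_
  rintro z ⟨hz, hzC⟩
  obtain ⟨a, b, rfl⟩ := h.mem_lattice_iff.1 hz
  have hb : |(b : ℝ)| ≤ B := by
    have h1 : |(b : ℝ)| * |τ.im| ≤ C := by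
      have := (Complex.abs_im_le_norm (a + b * τ)).trans hzC
      simpa [abs_mul] using this
    exact ((le_div_iff₀ him).2 h1).trans (Int.le_ceil _)
  have ha : |(a : ℝ)| ≤ A := by
    refine le_trans ?_ (Int.le_ceil _)
    have h1 : ‖(a : ℂ)‖ ≤ ‖(a : ℂ) + b * τ‖ + ‖(b : ℂ) * τ‖ := by
      simpa using norm_sub_le ((a : ℂ) + b * τ) (b * τ)
    rw [norm_mul, Complex.norm_intCast, Complex.norm_intCast] at h1
    nlinarith [norm_nonneg τ]
  refine ⟨(a, b), ⟨⟨?_, ?_⟩, ?_, ?_⟩, rfl⟩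
  · exact_mod_cast (abs_le.1 ha).1
  · exact_mod_cast (abs_le.1 ha).2
  · exact_mod_cast (abs_le.1 hb).1
  · exact_mod_cast (abs_le.1 hb).2

theorem exists_real_coords (h : IsImaginaryQuadraticBase τ p q) (z : ℂ) :
    ∃ s t : ℝ, z = s + t * τ := by
  refine ⟨z.re - z.im / τ.im * τ.re, z.im / τ.im, ?_⟩
  have := h.re_im.1
  apply Complex.ext <;> simp
  field_simp

theorem exists_lattice_norm_sub_le (h : IsImaginaryQuadraticBase τ p q) (z : ℂ) :
    ∃ u ∈ lattice τ, ‖z - u‖ ≤ 1 + ‖τ‖ := by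
  obtain ⟨s, t, rfl⟩ := h.exists_real_coords z
  refine ⟨⌊s⌋ + ⌊t⌋ * τ, h.mem_lattice_iff.2 ⟨_, _, rfl⟩, ?_⟩
  have e : (s + t * τ - (⌊s⌋ + ⌊t⌋ * τ) : ℂ) = (Int.fract s : ℝ) + (Int.fract t : ℝ) * τ := by
    rw [← Int.self_sub_floor, ← Int.self_sub_floor]
    push_cast
    ring
  rw [e]
  refine (norm_add_le _ _).trans ?_
  rw [norm_mul, Complex.norm_real, Complex.norm_real, Real.norm_of_nonneg (Int.fract_nonneg _),
    Real.norm_of_nonneg (Int.fract_nonneg _)]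
  have := Int.fract_lt_one s
  have := Int.fract_lt_one t
  nlinarith [norm_nonneg τ]

end IsImaginaryQuadraticBase

end Lattice

/-! ### Scaling and Lebesgue measure -/

/-- The image `a + c S` of a set `S` under the similarity `z ↦ a + c z` of the complex plane. -/
def similarCopy (a c : ℂ) (S : Set ℂ) : Set ℂ := (fun z => a + c * z) '' S

section SimilarCopy

variable {a c : ℂ} {S : Set ℂ}

theorem mem_similarCopy_iff_of_ne_zero (hc : c ≠ 0) {z : ℂ} :
    z ∈ similarCopy a c S ↔ c⁻¹ * (z - a) ∈ S := by
  constructor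
  · rintro ⟨s, hs, rfl⟩
    simpa [hc] using hs
  · intro hz
    exact ⟨_, hz, by field_simp; ring⟩

theorem similarCopy_similarCopy (a b c e : ℂ) (S : Set ℂ) :
    similarCopy a c (similarCopy b e S) = similarCopy (a + c * b) (c * e) S := by
  unfold similarCopy
  rw [Set.image_image]
  congr 1
  ext z
  ring

theorem similarCopy_mono {T : Set ℂ} (hST : S ⊆ T) : similarCopy a c S ⊆ similarCopy a c T :=
  Set.image_mono hST

theorem isCompact_similarCopy (hS : IsCompact S) : IsCompact (similarCopy a c S) :=
  hS.image (by fun_prop)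

theorem volume_similarCopy (a c : ℂ) (S : Set ℂ) :
    volume (similarCopy a c S) = ENNReal.ofReal (‖c‖ ^ 2) * volume S := by
  have e : similarCopy a c S = (fun z => a + z) '' (LinearMap.mulLeft ℝ c '' S) := by
    rw [Set.image_image]; rfl
  have hdet : LinearMap.det (LinearMap.mulLeft ℝ c) = Complex.normSq c := by
    rw [← Algebra.norm_complex_apply]; rfl
  rw [e, Set.image_add_left, measure_preimage_add, Measure.addHaar_image_linearMap, hdet,
    abs_of_nonneg (Complex.normSq_nonneg c), Complex.normSq_eq_norm_sq]

theorem aedisjoint_similarCopy {T : Set ℂ} (hc : c ≠ 0) (h : AEDisjoint volume S T) :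
    AEDisjoint volume (similarCopy a c S) (similarCopy a c T) := by
  have hinj : Function.Injective (fun z => a + c * z) := fun x y hxy => by
    simpa [hc] using hxy
  have : similarCopy a c S ∩ similarCopy a c T = similarCopy a c (S ∩ T) :=
    (Set.image_inter hinj).symm
  rw [AEDisjoint, this, volume_similarCopy, h, mul_zero]

theorem nullMeasurableSet_similarCopy (hc : c ≠ 0) (hS : NullMeasurableSet S) :
    NullMeasurableSet (similarCopy a c S) := by
  obtain ⟨T, -, hT, hST⟩ := hS.exists_measurable_superset_ae_eq
  have hTm : MeasurableSet (similarCopy a c T) := by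
    have : similarCopy a c T = (fun z => c⁻¹ * (z - a)) ⁻¹' T := by
      ext z
      exact mem_similarCopy_iff_of_ne_zero hc
    rw [this]
    exact hT.preimage (by fun_prop)
  have hinj : Function.Injective (fun z => a + c * z) := fun x y hxy => by
    simpa [hc] using hxy
  refine ⟨_, hTm, ?_⟩
  rw [← measure_symmDiff_eq_zero_iff] at hST ⊢
  have e : symmDiff (similarCopy a c S) (similarCopy a c T) = similarCopy a c (symmDiff S T) :=
    (Set.image_symmDiff hinj S T).symm
  rw [e, volume_similarCopy, (by rw [symmDiff_comm]; exact hST : volume (symmDiff S T) = 0),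
    mul_zero]

end SimilarCopy

/-! ### Restricted Voronoi cells as fundamental domains -/

/-- The lattice `τ ^ n ℤ[τ]`, as an additive subgroup of the complex plane. -/
def scaledLattice (τ : ℂ) (n : ℕ) : AddSubgroup ℂ where
  carrier := {z | ∃ u ∈ lattice τ, z = τ ^ n * u}
  zero_mem' := ⟨0, zero_mem_lattice, by simp⟩
  add_mem' := by
    rintro _ _ ⟨u, hu, rfl⟩ ⟨v, hv, rfl⟩
    exact ⟨u + v, add_mem_lattice hu hv, by ring⟩
  neg_mem' := by
    rintro _ ⟨u, hu, rfl⟩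
    exact ⟨-u, neg_mem_lattice hu, by ring⟩

/-- The elements of `ℤ[τ]` in `τ ^ n Vr`: a complete system of residues modulo `τ ^ n`. -/
def residues (τ : ℂ) (n : ℕ) (Vr : Set ℂ) : Set ℂ :=
  {x | x ∈ lattice τ ∧ ∃ v ∈ Vr, x = τ ^ n * v}

section Voronoi

variable {τ : ℂ} {p q : ℤ} {Vr : Set ℂ}

theorem isClosed_voronoiCell : IsClosed (voronoiCell τ) := by
  have : voronoiCell τ = ⋂ y ∈ lattice τ, {z | ‖z‖ ≤ ‖z - y‖} := by
    ext z; simp [voronoiCell]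
  rw [this]
  exact isClosed_biInter fun y _ => isClosed_le (by fun_prop) (by fun_prop)

theorem volume_setOf_norm_eq_norm_sub {u : ℂ} (hu : u ≠ 0) :
    volume {z : ℂ | ‖z‖ = ‖z - u‖} = 0 := by
  have e : {z : ℂ | ‖z‖ = ‖z - u‖} = (AffineSubspace.perpBisector (0 : ℂ) u : Set ℂ) := by
    ext z
    simp [AffineSubspace.mem_perpBisector_iff_dist_eq, dist_eq_norm]
  rw [e]
  exact Measure.addHaar_affineSubspace _ _ (by simpa using hu.symm)

namespace IsImaginaryQuadraticBase

theorem countable_scaledLattice (h : IsImaginaryQuadraticBase τ p q) (n : ℕ) :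
    Countable (scaledLattice τ n) := by
  refine Set.Countable.to_subtype ((h.countable_lattice.image (τ ^ n * ·)).mono ?_)
  rintro _ ⟨u, hu, rfl⟩
  exact ⟨u, hu, rfl⟩

theorem voronoiCell_subset_closedBall (h : IsImaginaryQuadraticBase τ p q) :
    voronoiCell τ ⊆ Metric.closedBall 0 (1 + ‖τ‖) := by
  intro z hz
  obtain ⟨u, hu, hzu⟩ := h.exists_lattice_norm_sub_le z
  simpa using (hz u hu).trans hzu

theorem finite_residues (h : IsImaginaryQuadraticBase τ p q)
    (hVr : IsRestrictedVoronoiCell τ Vr) (n : ℕ) : (residues τ n Vr).Finite := by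
  refine (h.finite_lattice_norm_le (‖τ‖ ^ n * (1 + ‖τ‖))).subset ?_
  rintro x ⟨hx, v, hv, rfl⟩
  refine ⟨hx, ?_⟩
  have := h.voronoiCell_subset_closedBall (hVr.subset hv)
  rw [mem_closedBall_zero_iff] at this
  rw [norm_mul, norm_pow]
  gcongr

theorem ae_eq_voronoiCell (h : IsImaginaryQuadraticBase τ p q)
    (hVr : IsRestrictedVoronoiCell τ Vr) : Vr =ᵐ[volume] voronoiCell τ := by
  -- Points of the cell outside `Vr` are equidistant from `0` and another lattice point.
  have hnull : volume (⋃ u ∈ lattice τ \ {0}, {z : ℂ | ‖z‖ = ‖z - u‖}) = 0 := by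
    rw [measure_biUnion_null_iff (h.countable_lattice.mono Set.sdiff_subset)]
    exact fun u hu => volume_setOf_norm_eq_norm_sub hu.2
  refine hVr.subset.eventuallyLE.antisymm (ae_le_set.2 (measure_mono_null ?_ hnull))
  rintro z ⟨hzV, hzr⟩
  obtain ⟨u, ⟨hu, hzu⟩, -⟩ := hVr.existsUnique z
  have hu0 : u ≠ 0 := by
    rintro rfl
    exact hzr (by simpa using hzu)
  simp only [Set.mem_iUnion]
  refine ⟨u, ⟨hu, hu0⟩, le_antisymm (hzV u hu) ?_⟩
  simpa using hVr.subset hzu (-u) (neg_mem_lattice hu)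

theorem nullMeasurableSet_restrictedVoronoiCell (h : IsImaginaryQuadraticBase τ p q)
    (hVr : IsRestrictedVoronoiCell τ Vr) : NullMeasurableSet Vr :=
  ⟨_, isClosed_voronoiCell.measurableSet, h.ae_eq_voronoiCell hVr⟩

theorem existsUnique_pow_mul (h : IsImaginaryQuadraticBase τ p q)
    (hVr : IsRestrictedVoronoiCell τ Vr) (n : ℕ) (z : ℂ) :
    ∃! u : ℂ, u ∈ lattice τ ∧ z - τ ^ n * u ∈ similarCopy 0 (τ ^ n) Vr := by
  have h0 := pow_ne_zero n h.ne_zero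
  have key : ∀ u, z - τ ^ n * u ∈ similarCopy 0 (τ ^ n) Vr ↔ (τ ^ n)⁻¹ * z - u ∈ Vr := by
    intro u
    rw [mem_similarCopy_iff_of_ne_zero h0]
    have : (τ ^ n)⁻¹ * (z - τ ^ n * u - 0) = (τ ^ n)⁻¹ * z - u := by field_simp; ring
    rw [this]
  simp only [key]
  exact hVr.existsUnique _

theorem isAddFundamentalDomain (h : IsImaginaryQuadraticBase τ p q)
    (hVr : IsRestrictedVoronoiCell τ Vr) (n : ℕ) :
    IsAddFundamentalDomain (scaledLattice τ n) (similarCopy 0 (τ ^ n) Vr) volume := by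
  have h0 := pow_ne_zero n h.ne_zero
  refine IsAddFundamentalDomain.mk' (nullMeasurableSet_similarCopy h0
    (h.nullMeasurableSet_restrictedVoronoiCell hVr)) fun z => ?_
  obtain ⟨u, ⟨hu, hzu⟩, huniq⟩ := h.existsUnique_pow_mul hVr n z
  refine ⟨⟨-(τ ^ n * u), neg_mem ⟨u, hu, rfl⟩⟩, ?_, ?_⟩
  · simpa [AddSubgroup.vadd_def, sub_eq_neg_add] using hzu
  · rintro ⟨_, v, hv, rfl⟩ hzv
    have := huniq (-v) ⟨neg_mem_lattice hv, by
      simpa [AddSubgroup.vadd_def, add_comm] using hzv⟩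
    simp [← this]

/-- A family of sets indexed by the lattice that tiles the plane up to null sets and is invariant
under translations by `τ ^ n ℤ[τ]`: the members indexed by a system of residues modulo `τ ^ n`
together have the measure of a fundamental domain of `τ ^ n ℤ[τ]`. -/
theorem sum_volume_residues (h : IsImaginaryQuadraticBase τ p q)
    (hVr : IsRestrictedVoronoiCell τ Vr) (n : ℕ) (T : ℂ → Set ℂ)
    (hmeas : ∀ x ∈ lattice τ, NullMeasurableSet (T x))
    (hshift : ∀ x ∈ lattice τ, ∀ u ∈ lattice τ, T (x + τ ^ n * u) = (τ ^ n * u) +ᵥ T x)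
    (hdisj : ∀ x ∈ lattice τ, ∀ y ∈ lattice τ, x ≠ y → AEDisjoint volume (T x) (T y))
    (hcover : ∀ z, ∃ x ∈ lattice τ, z ∈ T x) :
    ∑ r ∈ (h.finite_residues hVr n).toFinset, volume (T r) =
      ENNReal.ofReal (‖τ‖ ^ 2) ^ n * volume (voronoiCell τ) := by
  have := h.countable_scaledLattice n
  set R := (h.finite_residues hVr n).toFinset with hR
  have hRmem : ∀ r, r ∈ R ↔ r ∈ residues τ n Vr := by simp [hR]
  have hres : ∀ r, r ∈ residues τ n Vr ↔ r ∈ lattice τ ∧ r ∈ similarCopy 0 (τ ^ n) Vr := by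
    intro r
    refine and_congr_right fun _ => ⟨?_, ?_⟩
    · rintro ⟨v, hv, rfl⟩
      exact ⟨v, hv, by simp⟩
    · rintro ⟨v, hv, rfl⟩
      exact ⟨v, hv, by simp⟩
  have hfd : IsAddFundamentalDomain (scaledLattice τ n) (⋃ r ∈ R, T r) volume := by
    refine ⟨?_, ?_, ?_⟩
    · exact Finset.nullMeasurableSet_biUnion _ fun r hr => hmeas r ((hRmem r).1 hr).1
    · refine Filter.Eventually.of_forall fun z => ?_
      obtain ⟨x, hx, hzx⟩ := hcover z
      obtain ⟨u, ⟨hu, hxu⟩, -⟩ := h.existsUnique_pow_mul hVr n x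
      refine ⟨⟨τ ^ n * (-u), ⟨-u, neg_mem_lattice hu, rfl⟩⟩, ?_⟩
      simp only [Set.mem_iUnion]
      have hru := sub_mem_lattice hx (pow_mul_mem_lattice n hu)
      refine ⟨x - τ ^ n * u, (hRmem _).2 ((hres _).2 ⟨hru, hxu⟩), ?_⟩
      have e : x - τ ^ n * u = x + τ ^ n * (-u) := by ring
      rw [e, hshift x hx _ (neg_mem_lattice hu)]
      exact Set.vadd_mem_vadd_set hzx
    · rintro ⟨_, u, hu, rfl⟩ ⟨_, v, hv, rfl⟩ huv
      have huv' : u ≠ v := by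
        rintro rfl
        exact huv rfl
      have e : ∀ (u : ℂ) (hu : u ∈ lattice τ),
          ((⟨τ ^ n * u, u, hu, rfl⟩ : scaledLattice τ n) +ᵥ ⋃ r ∈ R, T r) =
            ⋃ r ∈ R, T (r + τ ^ n * u) := by
        intro u hu
        have : ((⟨τ ^ n * u, u, hu, rfl⟩ : scaledLattice τ n) +ᵥ ⋃ r ∈ R, T r) =
          (τ ^ n * u) +ᵥ ⋃ r ∈ R, T r := rfl
        rw [this]
        simp only [Set.vadd_set_iUnion]
        refine Set.iUnion₂_congr fun r hr => ?_
        rw [hshift r ((hRmem r).1 hr).1 u hu]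
      simp only [Function.onFun]
      rw [e u hu, e v hv]
      rw [AEDisjoint, Set.iUnion₂_inter]
      refine (measure_biUnion_null_iff R.countable_toSet).2 fun r hr => ?_
      rw [Set.inter_iUnion₂]
      refine (measure_biUnion_null_iff R.countable_toSet).2 fun s hs => ?_
      have hr' := (hres r).1 ((hRmem r).1 hr)
      have hs' := (hres s).1 ((hRmem s).1 hs)
      refine hdisj _ (add_mem_lattice hr'.1 (pow_mul_mem_lattice n hu))
        _ (add_mem_lattice hs'.1 (pow_mul_mem_lattice n hv)) fun hrs => huv' ?_
      refine (h.existsUnique_pow_mul hVr n (r + τ ^ n * u)).unique ⟨hu, ?_⟩ ⟨hv, ?_⟩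
      · simpa using hr'.2
      · rw [hrs]
        simpa using hs'.2
  have hvol := hfd.measure_eq (h.isAddFundamentalDomain hVr n)
  rw [measure_biUnion_finset₀ (fun r hr s hs hrs => hdisj r ((hRmem r).1 hr).1 s
    ((hRmem s).1 hs).1 hrs) (fun r hr => hmeas r ((hRmem r).1 hr).1), volume_similarCopy,
    measure_congr (h.ae_eq_voronoiCell hVr)] at hvol
  rw [hvol, norm_pow, ← pow_mul, mul_comm n, pow_mul, ENNReal.ofReal_pow (sq_nonneg _)]

theorem volume_voronoiCell (h : IsImaginaryQuadraticBase τ p q)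
    (hVr : IsRestrictedVoronoiCell τ Vr) :
    volume (voronoiCell τ) = ENNReal.ofReal |τ.im| := by
  -- The half-open parallelogram spanned by `1` and `τ` is another fundamental domain.
  have := h.countable_scaledLattice 0
  let f : ℂ →ₗ[ℝ] ℂ :=
    { toFun := fun z => z.re + z.im * τ
      map_add' := fun x y => by simp; ring
      map_smul' := fun c x => by simp; ring }
  have hf : ∀ z, f z = z.re + z.im * τ := fun z => rfl
  have hfinj : Function.Injective f := by
    intro x y hxy
    rw [hf, hf] at hxy
    have hi := congrArg Complex.im hxy
    have hr := congrArg Complex.re hxy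
    simp at hi hr
    have him : x.im = y.im := by
      rcases hi with hi | hi
      · exact hi
      · exact absurd hi h.re_im.1
    rw [him] at hr
    exact Complex.ext (by linarith) him
  have hdet : LinearMap.det f = τ.im := by
    rw [← LinearMap.det_toMatrix Complex.basisOneI, Matrix.det_fin_two]
    simp [LinearMap.toMatrix_apply, hf]
  set S : Set ℂ := Set.Ico (0 : ℝ) 1 ×ℂ Set.Ico (0 : ℝ) 1 with hS
  have hSmeas : MeasurableSet S :=
    (measurableSet_Ico.preimage Complex.measurable_re).inter
      (measurableSet_Ico.preimage Complex.measurable_im)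
  have hSvol : volume S = 1 := by
    have e : S = Complex.measurableEquivRealProd ⁻¹' (Set.Ico (0 : ℝ) 1 ×ˢ Set.Ico (0 : ℝ) 1) := by
      ext z
      simp [hS, Complex.mem_reProdIm]
    rw [e, Complex.volume_preserving_equiv_real_prod.measure_preimage
      (measurableSet_Ico.prod measurableSet_Ico).nullMeasurableSet,
      Measure.volume_eq_prod, Measure.prod_prod]
    simp
  have hfd : IsAddFundamentalDomain (scaledLattice τ 0) (f '' S) volume := by
    have hfm : MeasurableSet (f '' S) :=
      hSmeas.image_of_continuousOn_injOn f.continuous_of_finiteDimensional.continuousOn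
        hfinj.injOn
    refine IsAddFundamentalDomain.mk' hfm.nullMeasurableSet fun z => ?_
    obtain ⟨s, t, rfl⟩ := h.exists_real_coords z
    refine ⟨⟨τ ^ 0 * (((-⌊s⌋ : ℤ) : ℂ) + ((-⌊t⌋ : ℤ) : ℂ) * τ), _,
      h.mem_lattice_iff.2 ⟨_, _, rfl⟩, rfl⟩, ?_, ?_⟩
    · refine ⟨⟨Int.fract s, Int.fract t⟩, ?_, ?_⟩
      · simp [hS, Complex.mem_reProdIm, Int.fract_nonneg, Int.fract_lt_one]
      · have hfract : ∀ r : ℝ, ((Int.fract r : ℝ) : ℂ) = r - ⌊r⌋ := fun r => by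
          rw [← Int.self_sub_floor]
          push_cast
          rfl
        rw [hf, hfract, hfract, AddSubgroup.vadd_def]
        simp
        ring
    · rintro ⟨_, u, hu, rfl⟩ ⟨y, hy, hyz⟩
      obtain ⟨a, b, rfl⟩ := h.mem_lattice_iff.1 hu
      have e : f y = f ⟨a + s, b + t⟩ := by
        rw [hyz, hf, AddSubgroup.vadd_def]
        simp
        ring
      have e' := hfinj e
      rw [hS, Complex.mem_reProdIm, e'] at hy
      simp only [Set.mem_Ico] at hy
      obtain ⟨⟨h1, h2⟩, h3, h4⟩ := hy
      have ha : ⌊s⌋ = -a := Int.floor_eq_iff.2 ⟨by push_cast; linarith, by push_cast; linarith⟩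
      have hb : ⌊t⌋ = -b := Int.floor_eq_iff.2 ⟨by push_cast; linarith, by push_cast; linarith⟩
      simp [ha, hb]
  have hvol := hfd.measure_eq (h.isAddFundamentalDomain hVr 0)
  rw [Measure.addHaar_image_linearMap, hdet, hSvol, volume_similarCopy,
    measure_congr (h.ae_eq_voronoiCell hVr)] at hvol
  simpa using hvol.symm

/-- There are `|τ| ^ (2 n)` residues modulo `τ ^ n`. -/
theorem card_residues (h : IsImaginaryQuadraticBase τ p q)
    (hVr : IsRestrictedVoronoiCell τ Vr) (n : ℕ) :
    ((h.finite_residues hVr n).toFinset.card : ℝ) = (‖τ‖ ^ 2) ^ n := by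
  -- The translates of `Vr` by lattice points form a tiling to compare with.
  have key := h.sum_volume_residues hVr n (fun x => x +ᵥ Vr)
    (fun x _ => (h.nullMeasurableSet_restrictedVoronoiCell hVr).vadd x)
    (fun x _ u _ => by simp only [vadd_vadd, add_comm x])
    (fun x hx y hy hxy => by
      refine Disjoint.aedisjoint (Set.disjoint_left.2 ?_)
      rintro _ ⟨v, hv, rfl⟩ ⟨v', hv', hvv⟩
      refine hxy ((hVr.existsUnique (x + v)).unique ⟨hx, by simpa using hv⟩ ⟨hy, ?_⟩)
      have e : x + v - y = v' := by
        rw [← vadd_eq_add x v, show x +ᵥ v = y +ᵥ v' from hvv.symm]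
        simp
      rwa [e])
    (fun z => by
      obtain ⟨u, ⟨hu, hzu⟩, -⟩ := hVr.existsUnique z
      exact ⟨u, hu, z - u, hzu, by simp⟩)
  simp only [measure_vadd, measure_congr (h.ae_eq_voronoiCell hVr), Finset.sum_const,
    nsmul_eq_mul, h.volume_voronoiCell hVr] at key
  have hne : ENNReal.ofReal |τ.im| ≠ 0 := by simpa using h.re_im.1
  have h2 := (ENNReal.mul_left_inj hne ENNReal.ofReal_ne_top).1 key
  have h3 := congrArg ENNReal.toReal h2
  simpa using h3

end IsImaginaryQuadraticBase

end Voronoi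

/-! ### Values of non-adjacent forms -/

section NonAdjacentForms

variable {τ : ℂ} {D : Set ℂ} {w : ℕ} {ξ : ℤ → ℂ}

theorem isWNAF_iff :
    IsWNAF D w ξ ↔ (∀ j, ξ j ∈ D) ∧ ∀ j k, j < k → k < j + (w : ℤ) → ξ j = 0 ∨ ξ k = 0 := by
  refine and_congr_right fun _ => ⟨fun h j k hjk hkw => ?_, fun h j k hk l hl => ?_⟩
  · by_contra! hne
    exact hjk.ne (h j ⟨le_rfl, by omega, hne.1⟩ ⟨hjk.le, hkw, hne.2⟩)
  · obtain ⟨hk1, hk2, hk3⟩ := hk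
    obtain ⟨hl1, hl2, hl3⟩ := hl
    rcases lt_trichotomy k l with hkl | hkl | hkl
    · rcases h k l hkl (by omega) with h0 | h0
      exacts [absurd h0 hk3, absurd h0 hl3]
    · exact hkl
    · rcases h l k hkl (by omega) with h0 | h0
      exacts [absurd h0 hl3, absurd h0 hk3]

theorem mem_fractionalNAFs_iff :
    ξ ∈ fractionalNAFs D w ↔ (∀ j, ξ j ∈ D) ∧
      (∀ j k, j < k → k < j + (w : ℤ) → ξ j = 0 ∨ ξ k = 0) ∧ ∀ j, 0 ≤ j → ξ j = 0 := by
  rw [← and_assoc, ← isWNAF_iff]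
  rfl

theorem isCompact_fractionalNAFs (hD : D.Finite) : IsCompact (fractionalNAFs D w) := by
  have hcl : IsClosed {ξ : ℤ → ℂ | (∀ j k, j < k → k < j + (w : ℤ) → ξ j = 0 ∨ ξ k = 0) ∧
      ∀ j, 0 ≤ j → ξ j = 0} := by
    have hz : ∀ j : ℤ, IsClosed {ξ : ℤ → ℂ | ξ j = 0} := fun j =>
      isClosed_eq (continuous_apply j) continuous_const
    simp only [Set.ofPred_and, Set.ofPred_forall]
    exact (isClosed_iInter fun j => isClosed_iInter fun k => isClosed_iInter fun _ =>
      isClosed_iInter fun _ => (hz j).union (hz k)).inter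
      (isClosed_iInter fun j => isClosed_iInter fun _ => hz j)
  have e : fractionalNAFs D w = Set.univ.pi (fun _ : ℤ => D) ∩
      {ξ : ℤ → ℂ | (∀ j k, j < k → k < j + (w : ℤ) → ξ j = 0 ∨ ξ k = 0) ∧
        ∀ j, 0 ≤ j → ξ j = 0} := by
    ext ξ
    rw [mem_fractionalNAFs_iff]
    simp
  rw [e]
  exact (isCompact_univ_pi fun _ => hD.isCompact).inter_right hcl

theorem summable_geometric_natAbs (hτ : 1 < ‖τ‖) (C : ℝ) :
    Summable fun j : ℤ => C * ‖τ‖⁻¹ ^ j.natAbs := by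
  have hg : Summable fun n : ℕ => C * ‖τ‖⁻¹ ^ n :=
    (summable_geometric_of_lt_one (by positivity) (inv_lt_one_of_one_lt₀ hτ)).mul_left C
  exact Summable.of_nat_of_neg (by simpa using hg) (by simpa using hg)

theorem norm_mul_zpow_le (hτ : 1 < ‖τ‖) {C : ℝ} (hC : ∀ j, ‖ξ j‖ ≤ C)
    (h0 : ∀ j, 0 ≤ j → ξ j = 0) (j : ℤ) : ‖ξ j * τ ^ j‖ ≤ C * ‖τ‖⁻¹ ^ j.natAbs := by
  have hC0 : 0 ≤ C := (norm_nonneg _).trans (hC 0)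
  rcases le_or_gt 0 j with hj | hj
  · rw [h0 j hj, zero_mul, norm_zero]
    positivity
  · obtain ⟨n, rfl⟩ : ∃ n : ℕ, j = -n := ⟨j.natAbs, by omega⟩
    rw [norm_mul, zpow_neg, norm_inv, zpow_natCast, norm_pow, Int.natAbs_neg, Int.natAbs_natCast,
      inv_pow]
    gcongr
    exact hC _

theorem exists_norm_le_of_finite (hD : D.Finite) : ∃ C, ∀ η ∈ D, ‖η‖ ≤ C := by
  obtain ⟨C, hC⟩ := hD.isBounded.exists_norm_le
  exact ⟨C, hC⟩

theorem summable_of_mem_fractionalNAFs (hτ : 1 < ‖τ‖) (hD : D.Finite)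
    (hξ : ξ ∈ fractionalNAFs D w) : Summable fun j : ℤ => ξ j * τ ^ j := by
  obtain ⟨C, hC⟩ := exists_norm_le_of_finite hD
  rw [mem_fractionalNAFs_iff] at hξ
  exact .of_norm_bounded (summable_geometric_natAbs hτ C)
    (norm_mul_zpow_le hτ (fun j => hC _ (hξ.1 j)) hξ.2.2)

theorem isCompact_image_value (hτ : 1 < ‖τ‖) (hD : D.Finite) :
    IsCompact (value τ '' fractionalNAFs D w) := by
  obtain ⟨C, hC⟩ := exists_norm_le_of_finite hD
  refine (isCompact_fractionalNAFs hD).image_of_continuousOn ?_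
  refine continuousOn_tsum (fun j => ?_) (summable_geometric_natAbs hτ C) fun j ξ hξ => ?_
  · exact ((continuous_apply j).mul continuous_const).continuousOn
  · rw [mem_fractionalNAFs_iff] at hξ
    exact norm_mul_zpow_le hτ (fun j => hC _ (hξ.1 j)) hξ.2.2 j

theorem value_shift (h0 : τ ≠ 0) (ξ : ℤ → ℂ) (k : ℤ) :
    value τ (fun j => ξ (j + k)) = τ ^ (-k) * value τ ξ := by
  unfold value
  rw [← tsum_mul_left, ← (Equiv.addRight k).tsum_eq (fun j => τ ^ (-k) * (ξ j * τ ^ j))]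
  refine tsum_congr fun j => ?_
  rw [Equiv.coe_addRight, zpow_add₀ h0, zpow_neg]
  have := zpow_ne_zero k h0
  field_simp

theorem value_shift_natCast (h0 : τ ≠ 0) (ξ : ℤ → ℂ) (k : ℕ) :
    value τ (fun j => ξ (j + k)) = τ⁻¹ ^ k * value τ ξ := by
  rw [value_shift h0, zpow_neg, zpow_natCast, inv_pow]

theorem zero_mem_image_value (hD0 : 0 ∈ D) : 0 ∈ value τ '' fractionalNAFs D w := by
  refine ⟨fun _ => 0, mem_fractionalNAFs_iff.2 ⟨fun _ => hD0, fun _ _ _ _ => .inl rfl,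
    fun _ _ => rfl⟩, by simp [value]⟩

/-- Removing leading zeros: if `ξ` vanishes from index `-k` on, it is the shift of a fractional
non-adjacent form. -/
theorem exists_shift_of_vanishing (hξ : ξ ∈ fractionalNAFs D w) {k : ℕ}
    (hk : ∀ j, -(k : ℤ) ≤ j → ξ j = 0) :
    ∃ ζ ∈ fractionalNAFs D w, ξ = fun j => ζ (j + k) := by
  rw [mem_fractionalNAFs_iff] at hξ
  refine ⟨fun j => ξ (j - k), mem_fractionalNAFs_iff.2 ⟨fun j => hξ.1 _, fun j l hjl hlw =>
    hξ.2.1 _ _ (by omega) (by omega), fun j hj => hk _ (by omega)⟩, ?_⟩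
  funext j
  simp

theorem shift_mem_fractionalNAFs (hξ : ξ ∈ fractionalNAFs D w) (k : ℕ) :
    (fun j => ξ (j + k)) ∈ fractionalNAFs D w := by
  rw [mem_fractionalNAFs_iff] at hξ ⊢
  exact ⟨fun j => hξ.1 _, fun j l hjl hlw => hξ.2.1 _ _ (by omega) (by omega),
    fun j hj => hξ.2.2 _ (by omega)⟩

theorem image_value_leading_zero (h0 : τ ≠ 0) :
    value τ '' {ξ | ξ ∈ fractionalNAFs D w ∧ ξ (-1) = 0} =
      similarCopy 0 τ⁻¹ (value τ '' fractionalNAFs D w) := by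
  apply Set.Subset.antisymm
  · rintro _ ⟨ξ, ⟨hξ, hξ1⟩, rfl⟩
    obtain ⟨ζ, hζ, rfl⟩ := exists_shift_of_vanishing (k := 1) hξ fun j hj => by
      rcases hj.eq_or_lt with hj | hj
      · rw [← hj]
        exact hξ1
      · exact (mem_fractionalNAFs_iff.1 hξ).2.2 j (by push_cast at hj; omega)
    exact ⟨_, ⟨ζ, hζ, rfl⟩, by simp only [value_shift_natCast h0 ζ 1, pow_one, zero_add]⟩
  · rintro _ ⟨_, ⟨ζ, hζ, rfl⟩, rfl⟩
    refine ⟨fun j => ζ (j + (1 : ℕ)), ⟨shift_mem_fractionalNAFs hζ 1, ?_⟩,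
      by simp only [value_shift_natCast h0 ζ 1, pow_one, zero_add]⟩
    exact (mem_fractionalNAFs_iff.1 hζ).2.2 _ (by simp)

/-- A non-adjacent form that starts with a nonzero digit `η` continues with `w - 1` zeros, followed
by an arbitrary non-adjacent form. -/
theorem image_value_leading_ne_zero (hτ : 1 < ‖τ‖) (hD : D.Finite) (hD0 : 0 ∈ D) {η : ℂ}
    (hη : η ∈ D) (hη0 : η ≠ 0) (hw : w ≠ 0) :
    value τ '' {ξ | ξ ∈ fractionalNAFs D w ∧ ξ (-1) = η} =
      similarCopy (τ⁻¹ * η) (τ⁻¹ ^ w) (value τ '' fractionalNAFs D w) := by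
  have h0 : τ ≠ 0 := by
    rintro rfl
    norm_num at hτ
  -- The correspondence `ζ ↦ η 0 ⋯ 0 ζ`.
  let pre : (ℤ → ℂ) → ℤ → ℂ := fun ζ j => if j = -1 then η else ζ (j + w)
  have hval : ∀ ζ ∈ fractionalNAFs D w, value τ (pre ζ) = τ⁻¹ * η + τ⁻¹ ^ w * value τ ζ := by
    intro ζ hζ
    rw [← value_shift_natCast h0]
    have hs := summable_of_mem_fractionalNAFs hτ hD (shift_mem_fractionalNAFs hζ w)
    have h1 : HasSum (fun j : ℤ => (if j = -1 then τ⁻¹ * η else 0)) (τ⁻¹ * η) := by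
      simpa using hasSum_ite_eq (-1 : ℤ) (τ⁻¹ * η)
    refine HasSum.tsum_eq ((h1.add hs.hasSum).congr_fun ?_)
    intro j
    by_cases hj : j = -1
    · subst hj
      have : ζ (-1 + w) = 0 := (mem_fractionalNAFs_iff.1 hζ).2.2 _ (by omega)
      simp [pre, this, mul_comm]
    · simp [pre, hj]
  apply Set.Subset.antisymm
  · rintro _ ⟨ξ, ⟨hξ, hξ1⟩, rfl⟩
    have hξ' := mem_fractionalNAFs_iff.1 hξ
    let ζ : ℤ → ℂ := fun j => if j < 0 then ξ (j - w) else 0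
    have hζ : ζ ∈ fractionalNAFs D w := by
      refine mem_fractionalNAFs_iff.2 ⟨fun j => ?_, fun j k hjk hkw => ?_, fun j hj => ?_⟩
      · by_cases hj : j < 0 <;> simp [ζ, hj, hD0, hξ'.1]
      · by_cases hk : k < 0
        · have hj : j < 0 := by omega
          simpa [ζ, hj, hk] using hξ'.2.1 (j - w) (k - w) (by omega) (by omega)
        · simp [ζ, hk]
      · simp [ζ, not_lt.2 hj]
    have e : ξ = pre ζ := by
      funext j
      by_cases hj : j = -1
      · simp [pre, hj, hξ1]
      by_cases hjw : j + w < 0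
      · simp [pre, hj, ζ, hjw]
      · simp only [pre, hj, ζ, hjw, if_false]
        rcases le_or_gt 0 j with hj0 | hj0
        · exact hξ'.2.2 j hj0
        · rcases hξ'.2.1 j (-1) (by omega) (by omega) with h1 | h1
          · exact h1
          · exact absurd (hξ1.symm.trans h1) hη0
    rw [e, hval ζ hζ]
    exact ⟨_, ⟨ζ, hζ, rfl⟩, rfl⟩
  · rintro _ ⟨_, ⟨ζ, hζ, rfl⟩, rfl⟩
    have hζ' := mem_fractionalNAFs_iff.1 hζ
    refine ⟨pre ζ, ⟨mem_fractionalNAFs_iff.2 ⟨fun j => ?_, fun j k hjk hkw => ?_,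
      fun j hj => ?_⟩, by simp [pre]⟩, hval ζ hζ⟩
    · by_cases hj : j = -1
      · simp [pre, hj, hη]
      · simpa [pre, hj] using hζ'.1 _
    · by_cases hk : k = -1
      · left
        have hj : j ≠ -1 := by omega
        simpa [pre, hj] using hζ'.2.2 (j + w) (by omega)
      by_cases hj : j = -1
      · right
        simpa [pre, hk] using hζ'.2.2 (k + w) (by omega)
      simpa [pre, hj, hk] using hζ'.2.1 (j + w) (k + w) (by omega) (by omega)
    · have : j ≠ -1 := by omega
      simpa [pre, this] using hζ'.2.2 (j + w) (by omega)

theorem image_value_digit_eq (hτ : 1 < ‖τ‖) (hD : D.Finite) (hD0 : 0 ∈ D) {η : ℂ}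
    (hη : η ∈ D) (hη0 : η ≠ 0) (hw : w ≠ 0) :
    value τ '' {ξ | ξ ∈ fractionalNAFs D w ∧ ξ (-(w : ℤ)) = η} =
      similarCopy (τ⁻¹ ^ w * η) (τ⁻¹ ^ (w - 1) * τ⁻¹ ^ w) (value τ '' fractionalNAFs D w) := by
  have h0 : τ ≠ 0 := by
    rintro rfl
    norm_num at hτ
  have e : similarCopy (τ⁻¹ ^ w * η) (τ⁻¹ ^ (w - 1) * τ⁻¹ ^ w) (value τ '' fractionalNAFs D w) =
      similarCopy 0 (τ⁻¹ ^ (w - 1)) (value τ '' {ξ | ξ ∈ fractionalNAFs D w ∧ ξ (-1) = η}) := by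
    rw [image_value_leading_ne_zero hτ hD hD0 hη hη0 hw, similarCopy_similarCopy, zero_add,
      ← mul_assoc, pow_sub_one_mul hw]
  have hindex : -(w : ℤ) + ((w - 1 : ℕ) : ℤ) = -1 := by omega
  rw [e]
  apply Set.Subset.antisymm
  · rintro _ ⟨ξ, ⟨hξ, hξw⟩, rfl⟩
    have hξ' := mem_fractionalNAFs_iff.1 hξ
    obtain ⟨ζ, hζ, rfl⟩ := exists_shift_of_vanishing (k := w - 1) hξ fun j hj => by
      rcases le_or_gt 0 j with hj0 | hj0
      · exact hξ'.2.2 j hj0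
      · rcases hξ'.2.1 (-w) j (by omega) (by omega) with h1 | h1
        · exact absurd (hξw.symm.trans h1) hη0
        · exact h1
    refine ⟨_, ⟨ζ, ⟨hζ, ?_⟩, rfl⟩, by simp [value_shift_natCast h0 ζ (w - 1)]⟩
    simpa only [hindex] using hξw
  · rintro _ ⟨_, ⟨ζ, ⟨hζ, hζ1⟩, rfl⟩, rfl⟩
    refine ⟨fun j => ζ (j + (w - 1 : ℕ)), ⟨shift_mem_fractionalNAFs hζ _, ?_⟩,
      by simp [value_shift_natCast h0 ζ (w - 1)]⟩
    simpa only [hindex] using hζ1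

end NonAdjacentForms

/-! ### Finiteness of the non-adjacent forms of lattice points -/

open Classical in
/-- What remains of the lattice point `x` after removing the last digit of its width-`w`
non-adjacent form: if `x` is divisible by `τ`, then the last digit is `0`; otherwise it is
`x - τ ^ w u`, where `u` is the lattice point with `τ⁻ʷ x - u ∈ Vr`. -/
noncomputable def predecessor (τ : ℂ) (w : ℕ) (Vr : Set ℂ) (x : ℂ) : ℂ :=
  if ∃ y ∈ lattice τ, x = τ * y then τ⁻¹ * x
  else τ ^ (w - 1) * Classical.epsilon fun u => u ∈ lattice τ ∧ (τ ^ w)⁻¹ * x - u ∈ Vr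

section Predecessor

variable {τ : ℂ} {p q : ℤ} {Vr : Set ℂ} {w : ℕ} {x : ℂ}

namespace IsImaginaryQuadraticBase

theorem predecessor_mul (h : IsImaginaryQuadraticBase τ p q) {y : ℂ} (hy : y ∈ lattice τ) :
    predecessor τ w Vr (τ * y) = y := by
  rw [predecessor, if_pos ⟨y, hy, rfl⟩, inv_mul_cancel_left₀ h.ne_zero]

theorem iterate_predecessor_pow_mul (h : IsImaginaryQuadraticBase τ p q) (n : ℕ) {y : ℂ}
    (hy : y ∈ lattice τ) : (predecessor τ w Vr)^[n] (τ ^ n * y) = y := by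
  induction n with
  | zero => simp
  | succ n ih =>
    rw [Function.iterate_succ_apply, pow_succ', mul_assoc,
      h.predecessor_mul (pow_mul_mem_lattice n hy), ih]

theorem predecessor_zero (h : IsImaginaryQuadraticBase τ p q) : predecessor τ w Vr 0 = 0 := by
  simpa using h.predecessor_mul (w := w) (Vr := Vr) zero_mem_lattice

/-- A lattice point that is not divisible by `τ` ends with a nonzero digit and `w - 1` zeros. -/
theorem exists_predecessor_eq (h : IsImaginaryQuadraticBase τ p q)
    (hVr : IsRestrictedVoronoiCell τ Vr) (hw : w ≠ 0) (hx : x ∈ lattice τ)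
    (hdiv : ¬ ∃ y ∈ lattice τ, x = τ * y) :
    ∃ u ∈ lattice τ, (τ ^ w)⁻¹ * x - u ∈ Vr ∧ predecessor τ w Vr x = τ ^ (w - 1) * u ∧
      x - τ * predecessor τ w Vr x ∈ digitSet τ w Vr ∧ x - τ * predecessor τ w Vr x ≠ 0 := by
  have hu := Classical.epsilon_spec (hVr.existsUnique ((τ ^ w)⁻¹ * x)).exists
  set u := Classical.epsilon fun u => u ∈ lattice τ ∧ (τ ^ w)⁻¹ * x - u ∈ Vr
  have hpred : predecessor τ w Vr x = τ ^ (w - 1) * u := if_neg hdiv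
  have hmem : predecessor τ w Vr x ∈ lattice τ := hpred ▸ pow_mul_mem_lattice _ hu.1
  have hdigit : ¬ ∃ y ∈ lattice τ, x - τ * predecessor τ w Vr x = τ * y := by
    rintro ⟨y, hy, hxy⟩
    exact hdiv ⟨y + predecessor τ w Vr x, add_mem_lattice hy hmem, by linear_combination hxy⟩
  refine ⟨u, hu.1, hu.2, hpred, .inr ⟨sub_mem_lattice hx (mul_mem_lattice self_mem_lattice hmem),
    hdigit, _, hu.2, ?_⟩, fun h0 => hdigit ⟨0, zero_mem_lattice, by simpa using h0⟩⟩
  have := pow_ne_zero w h.ne_zero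
  rw [hpred, ← mul_assoc, mul_pow_sub_one hw]
  field_simp

theorem predecessor_mem_lattice (h : IsImaginaryQuadraticBase τ p q)
    (hVr : IsRestrictedVoronoiCell τ Vr) (hw : w ≠ 0) (hx : x ∈ lattice τ) :
    predecessor τ w Vr x ∈ lattice τ := by
  by_cases hdiv : ∃ y ∈ lattice τ, x = τ * y
  · obtain ⟨y, hy, rfl⟩ := hdiv
    rwa [h.predecessor_mul hy]
  · obtain ⟨u, hu, -, hpred, -⟩ := h.exists_predecessor_eq hVr hw hx hdiv
    rw [hpred]
    exact pow_mul_mem_lattice _ hu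

theorem iterate_predecessor_mem_lattice (h : IsImaginaryQuadraticBase τ p q)
    (hVr : IsRestrictedVoronoiCell τ Vr) (hw : w ≠ 0) (hx : x ∈ lattice τ) (n : ℕ) :
    (predecessor τ w Vr)^[n] x ∈ lattice τ := by
  induction n with
  | zero => exact hx
  | succ n ih =>
    rw [Function.iterate_succ_apply']
    exact h.predecessor_mem_lattice hVr hw ih

theorem exists_norm_sq_eq_natCast (h : IsImaginaryQuadraticBase τ p q) (hx : x ∈ lattice τ) :
    ∃ n : ℕ, ‖x‖ ^ 2 = n := by
  obtain ⟨a, b, rfl⟩ := h.mem_lattice_iff.1 hx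
  have e : ‖(a + b * τ : ℂ)‖ ^ 2 = ((a ^ 2 + a * b * p + b ^ 2 * q : ℤ) : ℝ) := by
    obtain ⟨-, h1, h2⟩ := h.re_im
    rw [Complex.sq_norm, Complex.normSq_apply]
    push_cast
    rw [← h1, ← h2]
    simp
    ring
  have hpos : 0 ≤ a ^ 2 + a * b * p + b ^ 2 * q := by
    have := sq_nonneg ‖(a + b * τ : ℂ)‖
    rw [e] at this
    exact_mod_cast this
  refine ⟨(a ^ 2 + a * b * p + b ^ 2 * q).toNat, ?_⟩
  rw [e]
  exact_mod_cast (Int.toNat_of_nonneg hpos).symm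

theorem two_le_q (h : IsImaginaryQuadraticBase τ p q) : 2 ≤ q := by
  have h1 : (1 : ℝ) < q := by
    rw [← h.norm_sq]
    exact one_lt_pow₀ h.one_lt_norm two_ne_zero
  have : 1 < q := by exact_mod_cast h1
  omega

/-- If neither one nor `w` steps decrease the norm of `x`, then all of the estimates
`|u| ≤ |τ⁻ʷ x| + |v| ≤ 2 |τ⁻ʷ x| ≤ |x|` for the decomposition `τ⁻ʷ x = u + v`, `v ∈ Vr`, are
equalities, which forces `v = -τ⁻ʷ x`. -/
theorem norm_eq_of_not_decreasing (h : IsImaginaryQuadraticBase τ p q)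
    (hVr : IsRestrictedVoronoiCell τ Vr) (hw : 2 ≤ w) (hx : x ∈ lattice τ) (hx0 : x ≠ 0)
    (h1 : ‖x‖ ≤ ‖predecessor τ w Vr x‖) (h2 : ‖x‖ ≤ ‖(predecessor τ w Vr)^[w] x‖) :
    ‖τ‖ ^ w = 2 ∧ (¬ ∃ y ∈ lattice τ, x = τ * y) ∧
      (predecessor τ w Vr)^[w] x = 2 * (τ ^ w)⁻¹ * x ∧
      (τ ^ w)⁻¹ * x ∉ Vr ∧ -((τ ^ w)⁻¹ * x) ∈ Vr := by
  have hxpos : 0 < ‖x‖ := norm_pos_iff.2 hx0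
  have hdiv : ¬ ∃ y ∈ lattice τ, x = τ * y := by
    rintro ⟨y, hy, rfl⟩
    rw [h.predecessor_mul hy, norm_mul] at h1
    rw [norm_mul] at hxpos
    have := h.one_lt_norm
    nlinarith [norm_nonneg y]
  obtain ⟨u, hu, hv, hpred, -, -⟩ := h.exists_predecessor_eq hVr (by omega : w ≠ 0) hx hdiv
  have hiter : (predecessor τ w Vr)^[w] x = u := by
    obtain ⟨m, rfl⟩ : ∃ m, w = m + 1 := ⟨w - 1, by omega⟩
    rw [Function.iterate_succ_apply, hpred]
    exact h.iterate_predecessor_pow_mul m hu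
  rw [hiter] at h2 ⊢
  set g := (τ ^ w)⁻¹ * x with hg
  have hgnorm : ‖g‖ * ‖τ‖ ^ w = ‖x‖ := by
    have : ‖τ‖ ≠ 0 := norm_ne_zero_iff.2 h.ne_zero
    rw [hg, norm_mul, norm_inv, norm_pow]
    field_simp
  have hvg : ‖g - u‖ ≤ ‖g‖ := by
    simpa using hVr.subset hv (-u) (neg_mem_lattice hu)
  have hug : ‖u‖ ≤ ‖g‖ + ‖g - u‖ := by
    simpa using norm_sub_le g (g - u)
  have hτ2 : 2 ≤ ‖τ‖ ^ w := by
    have hq : (2 : ℝ) ≤ ‖τ‖ ^ 2 := by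
      rw [h.norm_sq]
      exact_mod_cast h.two_le_q
    exact hq.trans (pow_le_pow_right₀ h.one_lt_norm.le hw)
  have hgpos : 0 < ‖g‖ := by
    rw [norm_pos_iff, hg]
    exact mul_ne_zero (inv_ne_zero (pow_ne_zero _ h.ne_zero)) hx0
  have hτw : ‖τ‖ ^ w = 2 := by nlinarith
  rw [hτw] at hgnorm
  have huv : g + (g - u) = 0 := by
    have hpar := parallelogram_law_with_norm ℝ g (g - u)
    rw [sub_sub_cancel] at hpar
    have e1 : ‖g - u‖ = ‖g‖ := by linarith
    have e2 : ‖u‖ = 2 * ‖g‖ := by linarith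
    rw [e1, e2] at hpar
    have : ‖g + (g - u)‖ * ‖g + (g - u)‖ = 0 := by linarith
    exact norm_eq_zero.1 (mul_self_eq_zero.1 this)
  refine ⟨hτw, hdiv, by rw [mul_assoc, ← hg]; linear_combination -huv, fun hgV => ?_, ?_⟩
  · have hu0 : u = 0 := (hVr.existsUnique g).unique ⟨hu, hv⟩ ⟨zero_mem_lattice, by simpa using hgV⟩
    rw [hu0, norm_zero] at h2
    linarith
  · rwa [neg_eq_of_add_eq_zero_right huv]

/-- The descent behind the existence of finite non-adjacent forms. If no iterate were smaller than
`x`, then the equality case would apply again and again, giving the iterates `x`, `c x`, `c ^ 2 x`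
with `c = 2 / τ ^ 2`; in the finitely many cases left this contradicts either the uniqueness of the
decomposition with respect to `Vr` or the non-divisibility of the iterates by `τ`. -/
theorem exists_norm_iterate_lt (h : IsImaginaryQuadraticBase τ p q)
    (hVr : IsRestrictedVoronoiCell τ Vr) (hw : 2 ≤ w) (hx : x ∈ lattice τ) (hx0 : x ≠ 0) :
    ∃ k, ‖(predecessor τ w Vr)^[k] x‖ < ‖x‖ := by
  by_contra! hmin
  have hmem := h.iterate_predecessor_mem_lattice hVr (by omega : w ≠ 0) hx
  have hxpos : 0 < ‖x‖ := norm_pos_iff.2 hx0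
  -- The equality case can be applied to every iterate that has the same norm as `x`.
  have hstep : ∀ k, ‖(predecessor τ w Vr)^[k] x‖ = ‖x‖ →
      ‖τ‖ ^ w = 2 ∧ (¬ ∃ y ∈ lattice τ, (predecessor τ w Vr)^[k] x = τ * y) ∧
      (predecessor τ w Vr)^[w + k] x = 2 * (τ ^ w)⁻¹ * (predecessor τ w Vr)^[k] x ∧
      (τ ^ w)⁻¹ * (predecessor τ w Vr)^[k] x ∉ Vr ∧
      -((τ ^ w)⁻¹ * (predecessor τ w Vr)^[k] x) ∈ Vr := by
    intro k hk
    rw [Function.iterate_add_apply]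
    refine h.norm_eq_of_not_decreasing hVr hw (hmem k) ?_ ?_ ?_
    · rw [← norm_pos_iff, hk]
      exact hxpos
    · rw [hk, ← Function.iterate_succ_apply' (predecessor τ w Vr)]
      exact hmin _
    · rw [hk, ← Function.iterate_add_apply]
      exact hmin _
  obtain ⟨hτw, -, hx1, hnot0, -⟩ := hstep 0 rfl
  -- Hence `w = 2` and `q = 2`.
  have hq : q = 2 := by
    have h1 : (q : ℝ) ≤ 2 := by
      rw [← hτw, ← h.norm_sq]
      exact pow_le_pow_right₀ h.one_lt_norm.le hw
    have : q ≤ 2 := by exact_mod_cast h1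
    have := h.two_le_q
    omega
  have hw2 : w = 2 := by
    have h1 : ‖τ‖ ^ w = ‖τ‖ ^ 2 := by
      rw [hτw, h.norm_sq, hq]
      norm_num
    exact (pow_right_injective₀ (zero_lt_one.trans h.one_lt_norm) h.one_lt_norm.ne') h1
  subst hw2
  subst hq
  have hc : ‖2 * (τ ^ 2)⁻¹‖ = 1 := by
    rw [norm_mul, norm_inv, norm_pow, hτw]
    norm_num
  set x1 := (predecessor τ 2 Vr)^[2 + 0] x
  have hn1 : ‖x1‖ = ‖x‖ := by
    rw [hx1, norm_mul, hc, one_mul, Function.iterate_zero_apply]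
  obtain ⟨-, hdiv1, hx2, -, hin1⟩ := hstep (2 + 0) hn1
  set x2 := (predecessor τ 2 Vr)^[2 + (2 + 0)] x
  have hn2 : ‖x2‖ = ‖x‖ := by
    rw [hx2, norm_mul, hc, one_mul]
    exact hn1
  obtain ⟨-, -, -, -, hin2⟩ := hstep (2 + (2 + 0)) hn2
  change ¬ ∃ y ∈ lattice τ, x1 = τ * y at hdiv1
  change -((τ ^ 2)⁻¹ * x1) ∈ Vr at hin1
  change -((τ ^ 2)⁻¹ * x2) ∈ Vr at hin2
  change (τ ^ 2)⁻¹ * x ∉ Vr at hnot0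
  change x1 = 2 * (τ ^ 2)⁻¹ * x at hx1
  change x2 = 2 * (τ ^ 2)⁻¹ * x1 at hx2
  have hroot := h.root
  have hτ0 := h.ne_zero
  have hsq : τ ^ 2 ≠ 0 := pow_ne_zero 2 h.ne_zero
  have hx1' : x1 * τ ^ 2 = 2 * x := by
    rw [hx1]
    field_simp
  have hx2' : x2 * τ ^ 2 = 2 * x1 := by
    rw [hx2]
    field_simp
  have hp : p ^ 2 < 8 := by
    have := h.disc
    omega
  have hp1 : -3 < p := by nlinarith
  have hp2 : p < 3 := by nlinarith
  -- The number `c = 2 / τ ^ 2` is `-1` for `p = 0` and `± i` for `p = ± 2`, so that `-x` is an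
  -- iterate; it satisfies `2 c ^ 2 + 3 c + 2 = 0` for `p = ± 1`, which makes `c x` a multiple of
  -- `2 = τ (p - τ)`.
  have hcases : p ^ 2 = 0 ∨ p ^ 2 = 1 ∨ p ^ 2 = 4 := by
    interval_cases p <;> simp
  have hpow : (τ ^ 2) ^ 2 = ((p : ℂ) ^ 2 - 4) * τ ^ 2 - 4 := by
    push_cast at hroot
    linear_combination (τ ^ 2 + p * τ + 2) * hroot
  have hpc : (p : ℂ) ^ 2 = ((p ^ 2 : ℤ) : ℂ) := by push_cast; rfl
  rw [hpc] at hpow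
  rcases hcases with hp | hp | hp <;> rw [hp] at hpow <;> push_cast at hpow
  · have hp0 : p = 0 := by simpa using hp
    have h2 : τ ^ 2 = -2 := by
      rw [hp0] at hroot
      push_cast at hroot
      linear_combination hroot
    have : x1 = -x := by
      rw [h2] at hx1'
      linear_combination (-1 / 2 : ℂ) * hx1'
    rw [this] at hin1
    exact hnot0 (by simpa using hin1)
  · have hrel : 2 * x2 + 3 * x1 + 2 * x = 0 := by
      have : τ ^ 2 * (2 * x2 + 3 * x1 + 2 * x) = 0 := by
        have h4 : τ ^ 2 * (τ ^ 2 * (2 * x2 + 3 * x1 + 2 * x)) = 0 := by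
          linear_combination (2 * τ ^ 2) * hx2' + (3 * τ ^ 2 + 4) * hx1' + 2 * x * hpow
        exact (mul_eq_zero.1 h4).resolve_left hsq
      exact (mul_eq_zero.1 this).resolve_left hsq
    refine hdiv1 ⟨(τ - p) * (x + x1 + x2), mul_mem_lattice
      (sub_mem_lattice self_mem_lattice (intCast_mem_lattice p))
      (add_mem_lattice (add_mem_lattice (hmem 0) (hmem _)) (hmem _)), ?_⟩
    push_cast at hroot
    linear_combination hrel - (x + x1 + x2) * hroot
  · have : x2 = -x := by
      have h4 : (τ ^ 2) ^ 2 * (x2 + x) = 0 := by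
        linear_combination τ ^ 2 * hx2' + 2 * hx1' + x * hpow
      have := (mul_eq_zero.1 h4).resolve_left (pow_ne_zero 2 hsq)
      linear_combination this
    rw [this] at hin2
    exact hnot0 (by simpa using hin2)

/-- Every lattice point has a finite width-`w` non-adjacent form. -/
theorem exists_iterate_predecessor_eq_zero (h : IsImaginaryQuadraticBase τ p q)
    (hVr : IsRestrictedVoronoiCell τ Vr) (hw : 2 ≤ w) (hx : x ∈ lattice τ) :
    ∃ n, (predecessor τ w Vr)^[n] x = 0 := by
  obtain ⟨N, hN⟩ := h.exists_norm_sq_eq_natCast hx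
  induction N using Nat.strong_induction_on generalizing x with
  | _ N ih =>
    by_cases hx0 : x = 0
    · exact ⟨0, hx0⟩
    obtain ⟨k, hk⟩ := h.exists_norm_iterate_lt hVr hw hx hx0
    have hmem := h.iterate_predecessor_mem_lattice hVr (by omega : w ≠ 0) hx k
    obtain ⟨M, hM⟩ := h.exists_norm_sq_eq_natCast hmem
    have hMN : M < N := by
      have : (M : ℝ) < N := by
        rw [← hM, ← hN]
        gcongr
      exact_mod_cast this
    obtain ⟨n, hn⟩ := ih M hMN hmem hM
    exact ⟨n + k, by rw [Function.iterate_add_apply, hn]⟩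

end IsImaginaryQuadraticBase

end Predecessor

/-! ### Fractional parts of sets with disjoint translates -/

section FractionalPart

variable {τ : ℂ} {p q : ℤ} {Vr : Set ℂ}

theorem IsImaginaryQuadraticBase.volume_fracPartImage (h : IsImaginaryQuadraticBase τ p q)
    (hVr : IsRestrictedVoronoiCell τ Vr) {A : Set ℂ} (hA : NullMeasurableSet A)
    (hdisj : ∀ u ∈ lattice τ, ∀ v ∈ lattice τ, u ≠ v → AEDisjoint volume (u +ᵥ A) (v +ᵥ A)) :
    volume (fracPartImage τ Vr A) = volume A := by
  have := h.countable_scaledLattice 0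
  have hfd := h.isAddFundamentalDomain hVr 0
  have hcopy : similarCopy 0 (τ ^ 0) Vr = Vr := by simp [similarCopy]
  rw [hcopy] at hfd
  have hmem : ∀ g : scaledLattice τ 0, (g : ℂ) ∈ lattice τ := by
    rintro ⟨_, u, hu, rfl⟩
    simpa using hu
  have e : fracPartImage τ Vr A = ⋃ g : scaledLattice τ 0, (g +ᵥ A) ∩ Vr := by
    ext v
    simp only [fracPartImage, Set.mem_ofPred_eq, Set.mem_iUnion, Set.mem_inter_iff]
    constructor
    · rintro ⟨hv, u, hu, huv⟩
      exact ⟨⟨-u, -u, neg_mem_lattice hu, by simp⟩, ⟨u + v, huv, by simp [AddSubgroup.vadd_def]⟩, hv⟩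
    · rintro ⟨g, ⟨a, ha, rfl⟩, hv⟩
      exact ⟨hv, -g, neg_mem_lattice (hmem g), by simpa [AddSubgroup.vadd_def] using ha⟩
  rw [e, hfd.measure_eq_tsum A]
  refine measure_iUnion₀ (fun g g' hgg => ?_) fun g => ?_
  · exact (hdisj g (hmem g) g' (hmem g') fun heq => hgg (Subtype.ext heq)).mono
      Set.inter_subset_left Set.inter_subset_left
  · exact NullMeasurableSet.inter (hA.vadd g) hfd.nullMeasurableSet

end FractionalPart

/-! ### Counting digits -/

/-- The least `e` such that `τ ^ n` divides `τ ^ e x`. -/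
noncomputable def divisionDepth (τ : ℂ) (n : ℕ) (x : ℂ) : ℕ :=
  sInf {e | ∃ y ∈ lattice τ, τ ^ e * x = τ ^ n * y}

section Depth

variable {τ : ℂ} {p q : ℤ} {Vr : Set ℂ} {w n : ℕ} {x : ℂ}

theorem exists_pow_divisionDepth_mul (hx : x ∈ lattice τ) :
    ∃ y ∈ lattice τ, τ ^ divisionDepth τ n x * x = τ ^ n * y :=
  Nat.sInf_mem (s := {e | ∃ y ∈ lattice τ, τ ^ e * x = τ ^ n * y}) ⟨n, x, hx, rfl⟩

theorem divisionDepth_le {e : ℕ} (he : ∃ y ∈ lattice τ, τ ^ e * x = τ ^ n * y) :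
    divisionDepth τ n x ≤ e := Nat.sInf_le he

theorem divisionDepth_pow_mul (hx : x ∈ lattice τ) : divisionDepth τ n (τ ^ n * x) = 0 :=
  Nat.le_zero.1 (divisionDepth_le ⟨x, hx, by simp⟩)

theorem divisionDepth_add_pow_mul {u : ℂ} (hu : u ∈ lattice τ) :
    divisionDepth τ n (x + τ ^ n * u) = divisionDepth τ n x := by
  unfold divisionDepth
  congr 1
  ext e
  constructor
  · rintro ⟨y, hy, hxy⟩
    exact ⟨y - τ ^ e * u, sub_mem_lattice hy (pow_mul_mem_lattice e hu), by
      linear_combination hxy⟩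
  · rintro ⟨y, hy, hxy⟩
    exact ⟨y + τ ^ e * u, add_mem_lattice hy (pow_mul_mem_lattice e hu), by
      linear_combination hxy⟩

namespace IsImaginaryQuadraticBase

theorem divisionDepth_succ_mul (h : IsImaginaryQuadraticBase τ p q) :
    divisionDepth τ (n + 1) (τ * x) = divisionDepth τ n x := by
  unfold divisionDepth
  congr 1
  ext e
  refine exists_congr fun y => and_congr_right fun _ => ?_
  rw [pow_succ', mul_left_comm, mul_assoc, mul_right_inj' h.ne_zero]

theorem divisionDepth_mul (hx : x ∈ lattice τ) :
    divisionDepth τ n (τ * x) = divisionDepth τ n x - 1 := by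
  have hshift : ∀ e, (∃ y ∈ lattice τ, τ ^ e * (τ * x) = τ ^ n * y) ↔
      ∃ y ∈ lattice τ, τ ^ (e + 1) * x = τ ^ n * y := fun e => by
    simp only [pow_succ, mul_assoc]
  apply le_antisymm
  · refine divisionDepth_le ?_
    rcases Nat.eq_zero_or_pos (divisionDepth τ n x) with h0 | h0
    · obtain ⟨y, hy, hxy⟩ := exists_pow_divisionDepth_mul (n := n) hx
      rw [h0] at hxy ⊢
      exact ⟨τ * y, mul_mem_lattice self_mem_lattice hy, by linear_combination τ * hxy⟩
    · rw [hshift, Nat.sub_add_cancel h0]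
      exact exists_pow_divisionDepth_mul hx
  · have := divisionDepth_le ((hshift _).1 (exists_pow_divisionDepth_mul (n := n)
      (mul_mem_lattice self_mem_lattice hx)))
    omega

theorem divisionDepth_of_not_dvd (h : IsImaginaryQuadraticBase τ p q) (hx : x ∈ lattice τ)
    (hdiv : ¬ ∃ y ∈ lattice τ, x = τ * y) : divisionDepth τ n x = n := by
  refine le_antisymm (divisionDepth_le ⟨x, hx, rfl⟩) ?_
  by_contra! hlt
  obtain ⟨y, hy, hxy⟩ := exists_pow_divisionDepth_mul (n := n) hx
  generalize divisionDepth τ n x = e at hlt hxy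
  obtain ⟨k, rfl⟩ : ∃ k, n = e + (k + 1) := ⟨n - e - 1, by omega⟩
  rw [pow_add, mul_assoc] at hxy
  have := mul_left_cancel₀ (pow_ne_zero e h.ne_zero) hxy
  exact hdiv ⟨τ ^ k * y, pow_mul_mem_lattice k hy, by rw [this, pow_succ', mul_assoc]⟩

open Classical in
theorem filter_dvd_residues (h : IsImaginaryQuadraticBase τ p q)
    (hVr : IsRestrictedVoronoiCell τ Vr) (n : ℕ) :
    ((h.finite_residues hVr (n + 1)).toFinset.filter fun x => ∃ y ∈ lattice τ, x = τ * y) =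
      (h.finite_residues hVr n).toFinset.image (τ * ·) := by
  ext x
  simp only [Finset.mem_filter, Set.Finite.mem_toFinset, Finset.mem_image, residues,
    Set.mem_ofPred_eq]
  constructor
  · rintro ⟨⟨-, v, hv, hxv⟩, y, hy, rfl⟩
    rw [pow_succ', mul_assoc, mul_right_inj' h.ne_zero] at hxv
    exact ⟨y, ⟨hy, v, hv, hxv⟩, rfl⟩
  · rintro ⟨y, ⟨hy, v, hv, rfl⟩, rfl⟩
    exact ⟨⟨mul_mem_lattice self_mem_lattice hy, v, hv, by ring⟩, _, hy, rfl⟩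

open Classical in
theorem card_filter_not_dvd_residues (h : IsImaginaryQuadraticBase τ p q)
    (hVr : IsRestrictedVoronoiCell τ Vr) (n : ℕ) :
    (((h.finite_residues hVr (n + 1)).toFinset.filter
      fun x => ¬ ∃ y ∈ lattice τ, x = τ * y).card : ℝ) = (‖τ‖ ^ 2) ^ n * (‖τ‖ ^ 2 - 1) := by
  have h1 := Finset.card_filter_add_card_filter_not (s := (h.finite_residues hVr (n + 1)).toFinset)
    (fun x => ∃ y ∈ lattice τ, x = τ * y)
  rw [h.filter_dvd_residues hVr n,
    Finset.card_image_of_injective _ (mul_right_injective₀ h.ne_zero)] at h1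
  have h2 := congrArg (Nat.cast : ℕ → ℝ) h1
  rw [Nat.cast_add, h.card_residues hVr, h.card_residues hVr] at h2
  rw [pow_succ (‖τ‖ ^ 2)] at h2
  linarith

theorem sum_inv_pow_divisionDepth (h : IsImaginaryQuadraticBase τ p q)
    (hVr : IsRestrictedVoronoiCell τ Vr) (n : ℕ) :
    ∑ r ∈ (h.finite_residues hVr n).toFinset, ((‖τ‖ ^ 2)⁻¹) ^ divisionDepth τ n r =
      1 + n * (1 - (‖τ‖ ^ 2)⁻¹) := by
  classical
  have hd : ‖τ‖ ≠ 0 := norm_ne_zero_iff.2 h.ne_zero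
  induction n with
  | zero =>
    have hcard := h.card_residues hVr 0
    rw [Finset.sum_congr rfl (g := fun _ => (1 : ℝ)) fun r hr => ?_]
    · simpa using hcard
    · have hr' : r ∈ lattice τ := by
        rw [Set.Finite.mem_toFinset] at hr
        exact hr.1
      have := divisionDepth_pow_mul (n := 0) hr'
      rw [pow_zero, one_mul] at this
      rw [this, pow_zero]
  | succ n ih =>
    rw [← Finset.sum_filter_add_sum_filter_not _ fun x => ∃ y ∈ lattice τ, x = τ * y,
      h.filter_dvd_residues hVr n,
      Finset.sum_image (mul_right_injective₀ h.ne_zero).injOn]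
    simp only [h.divisionDepth_succ_mul]
    rw [ih, Finset.sum_congr rfl (g := fun _ => ((‖τ‖ ^ 2)⁻¹) ^ (n + 1)) fun r hr => ?_]
    · rw [Finset.sum_const, nsmul_eq_mul, h.card_filter_not_dvd_residues hVr n]
      push_cast
      simp only [inv_pow]
      field_simp
      ring
    · rw [Finset.mem_filter, Set.Finite.mem_toFinset] at hr
      rw [h.divisionDepth_of_not_dvd hr.1.1 hr.2]

theorem finite_digitSet (h : IsImaginaryQuadraticBase τ p q)
    (hVr : IsRestrictedVoronoiCell τ Vr) (w : ℕ) : (digitSet τ w Vr).Finite := by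
  refine (Set.finite_singleton 0).union ((h.finite_residues hVr w).subset ?_)
  rintro η ⟨h1, -, h2⟩
  exact ⟨h1, h2⟩

end IsImaginaryQuadraticBase

theorem zero_mem_digitSet : (0 : ℂ) ∈ digitSet τ w Vr := .inl rfl

theorem not_dvd_of_mem_digitSet {η : ℂ} (hη : η ∈ digitSet τ w Vr) (hη0 : η ≠ 0) :
    η ∈ lattice τ ∧ ¬ ∃ y ∈ lattice τ, η = τ * y := by
  rcases hη with hη | hη
  · exact absurd hη hη0
  · exact ⟨hη.1, hη.2.1⟩

end Depth

/-! ### The self-similarity of the fundamental domain -/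

/-- If the measures of finitely many sets add up to at most the measure of their union, then the
sets are pairwise disjoint up to null sets. -/
theorem aedisjoint_of_sum_measure_le {α ι : Type*} [MeasurableSpace α] {μ : Measure α}
    {s : Finset ι} {A : ι → Set α} (hA : ∀ i ∈ s, NullMeasurableSet (A i) μ)
    (hfin : ∀ i ∈ s, μ (A i) ≠ ∞) (hsum : ∑ i ∈ s, μ (A i) ≤ μ (⋃ i ∈ s, A i)) {i j : ι}
    (hi : i ∈ s) (hj : j ∈ s) (hij : i ≠ j) : AEDisjoint μ (A i) (A j) := by
  classical
  set t := (s.erase i).erase j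
  have hsplit : ∑ k ∈ s, μ (A k) = μ (A i) + μ (A j) + ∑ k ∈ t, μ (A k) := by
    rw [← Finset.add_sum_erase s _ hi,
      ← Finset.add_sum_erase (s.erase i) _ (Finset.mem_erase.2 ⟨hij.symm, hj⟩), add_assoc]
  have hunion : μ (⋃ k ∈ s, A k) ≤ μ (A i ∪ A j) + ∑ k ∈ t, μ (A k) := by
    refine (measure_mono ?_).trans ((measure_union_le (A i ∪ A j) (⋃ k ∈ t, A k)).trans
      (by gcongr; exact measure_biUnion_finset_le t A))
    intro x hx
    simp only [Set.mem_iUnion] at hx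
    obtain ⟨k, hk, hxk⟩ := hx
    by_cases hki : k = i
    · exact .inl (.inl (hki ▸ hxk))
    by_cases hkj : k = j
    · exact .inl (.inr (hkj ▸ hxk))
    · refine .inr ?_
      simp only [Set.mem_iUnion]
      exact ⟨k, Finset.mem_erase.2 ⟨hkj, Finset.mem_erase.2 ⟨hki, hk⟩⟩, hxk⟩
  have ht : ∑ k ∈ t, μ (A k) ≠ ∞ := ENNReal.sum_ne_top.2 fun k hk =>
    hfin k (Finset.mem_of_mem_erase (Finset.mem_of_mem_erase hk))
  have hle : μ (A i) + μ (A j) ≤ μ (A i ∪ A j) :=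
    (ENNReal.add_le_add_iff_right ht).1 (hsplit ▸ hsum.trans hunion)
  rw [← measure_union_add_inter₀ (A i) (hA j hj)] at hle
  have hU : μ (A i ∪ A j) ≠ ∞ := measure_union_ne_top (hfin i hi) (hfin j hj)
  exact nonpos_iff_eq_zero.1 ((ENNReal.add_le_add_iff_left hU).1 (by simpa using hle))

open Classical in
/-- The part of `τ F`, `F` the fundamental domain, that consists of the values of the non-adjacent
forms with digit `η` at index `0`. -/
noncomputable def digitPiece (τ : ℂ) (w : ℕ) (Vr : Set ℂ) (η : ℂ) : Set ℂ :=
  if η = 0 then fundamentalDomain τ w Vr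
  else similarCopy η (τ⁻¹ ^ (w - 1)) (fundamentalDomain τ w Vr)

section SelfSimilarity

variable {τ : ℂ} {p q : ℤ} {Vr : Set ℂ} {w : ℕ}

theorem digitPiece_zero : digitPiece τ w Vr 0 = fundamentalDomain τ w Vr := if_pos rfl

theorem digitPiece_of_ne_zero {η : ℂ} (hη : η ≠ 0) :
    digitPiece τ w Vr η = similarCopy η (τ⁻¹ ^ (w - 1)) (fundamentalDomain τ w Vr) := if_neg hη

namespace IsImaginaryQuadraticBase

theorem isCompact_fundamentalDomain (h : IsImaginaryQuadraticBase τ p q)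
    (hVr : IsRestrictedVoronoiCell τ Vr) : IsCompact (fundamentalDomain τ w Vr) :=
  isCompact_image_value h.one_lt_norm (h.finite_digitSet hVr w)

theorem isCompact_digitPiece (h : IsImaginaryQuadraticBase τ p q)
    (hVr : IsRestrictedVoronoiCell τ Vr) (η : ℂ) : IsCompact (digitPiece τ w Vr η) := by
  unfold digitPiece
  split_ifs
  · exact h.isCompact_fundamentalDomain hVr
  · exact isCompact_similarCopy (h.isCompact_fundamentalDomain hVr)

theorem similarCopy_fundamentalDomain (h : IsImaginaryQuadraticBase τ p q)
    (hVr : IsRestrictedVoronoiCell τ Vr) (hw : w ≠ 0) :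
    similarCopy 0 τ (fundamentalDomain τ w Vr) = ⋃ η ∈ digitSet τ w Vr, digitPiece τ w Vr η := by
  have hsplit : fundamentalDomain τ w Vr = ⋃ η ∈ digitSet τ w Vr,
      value τ '' {ξ | ξ ∈ fractionalNAFs (digitSet τ w Vr) w ∧ ξ (-1) = η} := by
    ext z
    simp only [Set.mem_iUnion]
    constructor
    · rintro ⟨ξ, hξ, rfl⟩
      exact ⟨ξ (-1), (mem_fractionalNAFs_iff.1 hξ).1 _, ξ, ⟨hξ, rfl⟩, rfl⟩
    · rintro ⟨η, -, ξ, ⟨hξ, -⟩, rfl⟩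
      exact ⟨ξ, hξ, rfl⟩
  have hunion : similarCopy 0 τ (fundamentalDomain τ w Vr) = ⋃ η ∈ digitSet τ w Vr,
      similarCopy 0 τ (value τ '' {ξ | ξ ∈ fractionalNAFs (digitSet τ w Vr) w ∧ ξ (-1) = η}) := by
    rw [hsplit]
    simp only [similarCopy, Set.image_iUnion]
  rw [hunion]
  refine Set.iUnion₂_congr fun η hη => ?_
  have hD := h.finite_digitSet hVr w
  by_cases hη0 : η = 0
  · subst hη0
    rw [image_value_leading_zero h.ne_zero, digitPiece_zero, similarCopy_similarCopy,
      mul_inv_cancel₀ h.ne_zero]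
    simp [similarCopy, fundamentalDomain]
  · rw [image_value_leading_ne_zero h.one_lt_norm hD zero_mem_digitSet hη hη0 hw,
      digitPiece_of_ne_zero hη0, similarCopy_similarCopy, mul_inv_cancel_left₀ h.ne_zero, zero_add,
      ← mul_pow_sub_one hw, mul_inv_cancel_left₀ h.ne_zero]
    rfl

/-- The pieces of `τ F` that belong to the single digits have the same total measure as `τ F`,
whatever the measure of `F` is; hence they do not overlap. -/
theorem aedisjoint_digitPiece (h : IsImaginaryQuadraticBase τ p q)
    (hVr : IsRestrictedVoronoiCell τ Vr) (hw : w ≠ 0) {η η' : ℂ} (hη : η ∈ digitSet τ w Vr)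
    (hη' : η' ∈ digitSet τ w Vr) (hne : η ≠ η') :
    AEDisjoint volume (digitPiece τ w Vr η) (digitPiece τ w Vr η') := by
  classical
  have hD := h.finite_digitSet hVr w
  have hd : ‖τ‖ ≠ 0 := norm_ne_zero_iff.2 h.ne_zero
  refine aedisjoint_of_sum_measure_le (s := hD.toFinset)
    (fun η _ => (h.isCompact_digitPiece hVr η).measurableSet.nullMeasurableSet)
    (fun η _ => (h.isCompact_digitPiece hVr η).measure_ne_top) ?_
    (hD.mem_toFinset.2 hη) (hD.mem_toFinset.2 hη') hne
  have hU : (⋃ η ∈ hD.toFinset, digitPiece τ w Vr η) =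
      similarCopy 0 τ (fundamentalDomain τ w Vr) := by
    rw [h.similarCopy_fundamentalDomain hVr hw]
    simp
  obtain ⟨n, rfl⟩ : ∃ n, w = n + 1 := ⟨w - 1, by omega⟩
  set N := (h.finite_residues hVr (n + 1)).toFinset.filter fun x => ¬ ∃ y ∈ lattice τ, x = τ * y
  have hN0 : ∀ η ∈ N, η ≠ 0 := by
    rintro _ hη rfl
    exact (Finset.mem_filter.1 hη).2 ⟨0, zero_mem_lattice, by simp⟩
  have hDN : hD.toFinset = insert 0 N := by
    ext η
    simp only [N, digitSet, residues, Set.Finite.mem_toFinset, Finset.mem_insert,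
      Finset.mem_filter, Set.mem_union, Set.mem_singleton_iff, Set.mem_ofPred_eq]
    tauto
  rw [hU, hDN, Finset.sum_insert fun h0 => hN0 0 h0 rfl, digitPiece_zero,
    Finset.sum_congr rfl fun η hη => by
      rw [digitPiece_of_ne_zero (hN0 η hη), volume_similarCopy],
    Finset.sum_const, nsmul_eq_mul, volume_similarCopy, ← mul_assoc]
  nth_rewrite 1 [← one_mul (volume (fundamentalDomain τ (n + 1) Vr))]
  rw [← add_mul, ← ENNReal.ofReal_natCast, h.card_filter_not_dvd_residues hVr n,
    ← ENNReal.ofReal_one, ← ENNReal.ofReal_mul (by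
      have := one_le_pow₀ h.one_lt_norm.le (n := 2)
      exact mul_nonneg (by positivity) (by linarith)),
    ← ENNReal.ofReal_add zero_le_one (by
      have := one_le_pow₀ h.one_lt_norm.le (n := 2)
      exact mul_nonneg (mul_nonneg (by positivity) (by linarith)) (by positivity))]
  refine le_of_eq ?_
  congr 2
  rw [norm_pow, norm_inv, inv_pow, Nat.add_sub_cancel]
  field_simp
  ring

end IsImaginaryQuadraticBase

end SelfSimilarity

/-! ### The tiling of the plane -/

/-- The tile of a lattice point `x`: the set of all `x + f`, where `f` is the value of a fractional
non-adjacent form that can follow the non-adjacent form of `x`. If the last nonzero digit of `x`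
has index `k`, then `f` has to start with `w - 1 - k` zeros. -/
noncomputable def tile (τ : ℂ) (w : ℕ) (Vr : Set ℂ) (x : ℂ) : Set ℂ :=
  similarCopy x (τ⁻¹ ^ divisionDepth τ (w - 1) x) (fundamentalDomain τ w Vr)

section Tiling

variable {τ : ℂ} {p q : ℤ} {Vr : Set ℂ} {w : ℕ} {x : ℂ}

theorem tile_add_pow_mul {u : ℂ} (hu : u ∈ lattice τ) :
    tile τ w Vr (x + τ ^ (w - 1) * u) = (τ ^ (w - 1) * u) +ᵥ tile τ w Vr x := by
  unfold tile
  rw [divisionDepth_add_pow_mul hu]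
  unfold similarCopy
  rw [← Set.image_vadd, Set.image_image]
  congr 1
  ext z
  rw [vadd_eq_add]
  ring

theorem self_mem_tile (x : ℂ) : x ∈ tile τ w Vr x :=
  ⟨0, zero_mem_image_value zero_mem_digitSet, by simp⟩

namespace IsImaginaryQuadraticBase

theorem isCompact_tile (h : IsImaginaryQuadraticBase τ p q)
    (hVr : IsRestrictedVoronoiCell τ Vr) (x : ℂ) : IsCompact (tile τ w Vr x) :=
  isCompact_similarCopy (h.isCompact_fundamentalDomain hVr)

theorem sub_mul_predecessor_mem_digitSet (h : IsImaginaryQuadraticBase τ p q)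
    (hVr : IsRestrictedVoronoiCell τ Vr) (hw : w ≠ 0) (hx : x ∈ lattice τ) :
    x - τ * predecessor τ w Vr x ∈ digitSet τ w Vr := by
  by_cases hdiv : ∃ y ∈ lattice τ, x = τ * y
  · obtain ⟨y, hy, rfl⟩ := hdiv
    rw [h.predecessor_mul hy, sub_self]
    exact zero_mem_digitSet
  · obtain ⟨u, -, -, -, hdigit, -⟩ := h.exists_predecessor_eq hVr hw hx hdiv
    exact hdigit

theorem tile_eq_digitPiece (h : IsImaginaryQuadraticBase τ p q)
    (hVr : IsRestrictedVoronoiCell τ Vr) (hw : w ≠ 0) (hx : x ∈ lattice τ)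
    (hdepth : divisionDepth τ (w - 1) (predecessor τ w Vr x) = 0) :
    tile τ w Vr x = similarCopy (τ * predecessor τ w Vr x) 1
      (digitPiece τ w Vr (x - τ * predecessor τ w Vr x)) := by
  by_cases hdiv : ∃ y ∈ lattice τ, x = τ * y
  · obtain ⟨y, hy, rfl⟩ := hdiv
    rw [h.predecessor_mul hy] at hdepth ⊢
    rw [sub_self, digitPiece_zero, tile, divisionDepth_mul hy, hdepth, zero_tsub, pow_zero]
  · obtain ⟨u, -, -, -, -, hη0⟩ := h.exists_predecessor_eq hVr hw hx hdiv
    rw [digitPiece_of_ne_zero hη0, similarCopy_similarCopy, tile,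
      h.divisionDepth_of_not_dvd hx hdiv, one_mul, one_mul, add_sub_cancel]

theorem eq_mul_predecessor_of_divisionDepth_ne_zero (h : IsImaginaryQuadraticBase τ p q)
    (hVr : IsRestrictedVoronoiCell τ Vr) (hw : w ≠ 0) (hx : x ∈ lattice τ)
    (hdepth : divisionDepth τ (w - 1) (predecessor τ w Vr x) ≠ 0) :
    x = τ * predecessor τ w Vr x := by
  by_cases hdiv : ∃ y ∈ lattice τ, x = τ * y
  · obtain ⟨y, hy, rfl⟩ := hdiv
    rw [h.predecessor_mul hy]
  · obtain ⟨u, hu, -, hpred, -⟩ := h.exists_predecessor_eq hVr hw hx hdiv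
    rw [hpred, divisionDepth_pow_mul hu] at hdepth
    exact absurd rfl hdepth

theorem tile_subset (h : IsImaginaryQuadraticBase τ p q)
    (hVr : IsRestrictedVoronoiCell τ Vr) (hw : w ≠ 0) (hx : x ∈ lattice τ) :
    tile τ w Vr x ⊆ similarCopy 0 τ (tile τ w Vr (predecessor τ w Vr x)) := by
  have hpred := h.predecessor_mem_lattice hVr hw hx
  by_cases hdepth : divisionDepth τ (w - 1) (predecessor τ w Vr x) = 0
  · have e : similarCopy 0 τ (tile τ w Vr (predecessor τ w Vr x)) =
        similarCopy (τ * predecessor τ w Vr x) 1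
          (similarCopy 0 τ (fundamentalDomain τ w Vr)) := by
      rw [tile, similarCopy_similarCopy, similarCopy_similarCopy, hdepth]
      simp
    rw [e, h.tile_eq_digitPiece hVr hw hx hdepth, h.similarCopy_fundamentalDomain hVr hw]
    exact similarCopy_mono (Set.subset_biUnion_of_mem (u := digitPiece τ w Vr)
      (h.sub_mul_predecessor_mem_digitSet hVr hw hx))
  · have hx' := h.eq_mul_predecessor_of_divisionDepth_ne_zero hVr hw hx hdepth
    rw [tile, tile, similarCopy_similarCopy, zero_add, ← hx']
    nth_rewrite 2 [hx']
    rw [divisionDepth_mul hpred, ← mul_pow_sub_one hdepth, mul_inv_cancel_left₀ h.ne_zero]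

/-- Different lattice points have disjoint tiles up to null sets: their non-adjacent forms are
finite, so that both tiles are contained in `τ ^ n F` for some `n`, and the parts of `τ ^ n F` do
not overlap because they do not do so in any single step. -/
theorem aedisjoint_tile (h : IsImaginaryQuadraticBase τ p q)
    (hVr : IsRestrictedVoronoiCell τ Vr) (hw : 2 ≤ w) {x x' : ℂ} (hx : x ∈ lattice τ)
    (hx' : x' ∈ lattice τ) (hne : x ≠ x') :
    AEDisjoint volume (tile τ w Vr x) (tile τ w Vr x') := by
  have hw0 : w ≠ 0 := by omega
  have key : ∀ n, ∀ x ∈ lattice τ, ∀ x' ∈ lattice τ, (predecessor τ w Vr)^[n] x = 0 →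
      (predecessor τ w Vr)^[n] x' = 0 → x ≠ x' →
      AEDisjoint volume (tile τ w Vr x) (tile τ w Vr x') := by
    intro n
    induction n with
    | zero =>
      intro x _ x' _ h0 h0' hne
      exact absurd (h0.trans h0'.symm) hne
    | succ n ih =>
      intro x hx x' hx' h0 h0' hne
      by_cases hpred : predecessor τ w Vr x = predecessor τ w Vr x'
      · by_cases hdepth : divisionDepth τ (w - 1) (predecessor τ w Vr x) = 0
        · rw [h.tile_eq_digitPiece hVr hw0 hx hdepth,
            h.tile_eq_digitPiece hVr hw0 hx' (hpred ▸ hdepth), ← hpred]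
          refine aedisjoint_similarCopy one_ne_zero (h.aedisjoint_digitPiece hVr hw0
            (h.sub_mul_predecessor_mem_digitSet hVr hw0 hx) ?_ fun heq => hne ?_)
          · rw [hpred]
            exact h.sub_mul_predecessor_mem_digitSet hVr hw0 hx'
          · linear_combination heq
        · refine absurd ?_ hne
          rw [h.eq_mul_predecessor_of_divisionDepth_ne_zero hVr hw0 hx hdepth, hpred,
            ← h.eq_mul_predecessor_of_divisionDepth_ne_zero hVr hw0 hx' (hpred ▸ hdepth)]
      · rw [Function.iterate_succ_apply] at h0 h0'
        exact (aedisjoint_similarCopy h.ne_zero (ih _ (h.predecessor_mem_lattice hVr hw0 hx) _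
          (h.predecessor_mem_lattice hVr hw0 hx') h0 h0' hpred)).mono
          (h.tile_subset hVr hw0 hx) (h.tile_subset hVr hw0 hx')
  obtain ⟨n, hn⟩ := h.exists_iterate_predecessor_eq_zero hVr hw hx
  obtain ⟨m, hm⟩ := h.exists_iterate_predecessor_eq_zero hVr hw hx'
  have hzero : ∀ k, (predecessor τ w Vr)^[k] 0 = 0 := fun k =>
    Function.iterate_fixed h.predecessor_zero k
  refine key (m + n) x hx x' hx' ?_ ?_ hne
  · rw [Function.iterate_add_apply, hn, hzero]
  · rw [add_comm, Function.iterate_add_apply, hm, hzero]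

/-- The tiles cover the plane: their union contains all of the lattices `τ ^ (-n) ℤ[τ]`, and it is
closed since only finitely many tiles meet a given bounded set. -/
theorem exists_mem_tile (h : IsImaginaryQuadraticBase τ p q)
    (hVr : IsRestrictedVoronoiCell τ Vr) (hw : w ≠ 0) (z : ℂ) :
    ∃ x ∈ lattice τ, z ∈ tile τ w Vr x := by
  have hτpos : 0 < ‖τ‖ := zero_lt_one.trans h.one_lt_norm
  -- Division by `τ` preserves the union of the tiles.
  have hdivide : ∀ n, ∀ u ∈ lattice τ, ∃ x ∈ lattice τ, τ⁻¹ ^ n * u ∈ tile τ w Vr x := by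
    intro n
    induction n with
    | zero => exact fun u hu => ⟨u, hu, by simpa using self_mem_tile u⟩
    | succ n ih =>
      intro u hu
      obtain ⟨x, hx, hux⟩ := ih u hu
      have := (mem_similarCopy_iff_of_ne_zero h.ne_zero).1 (h.tile_subset hVr hw hx hux)
      rw [sub_zero, ← mul_assoc, ← pow_succ'] at this
      exact ⟨_, h.predecessor_mem_lattice hVr hw hx, this⟩
  choose u hu hzu using fun n : ℕ => h.exists_lattice_norm_sub_le (τ ^ n * z)
  have hdist : ∀ n, ‖z - τ⁻¹ ^ n * u n‖ ≤ (1 + ‖τ‖) * ‖τ‖⁻¹ ^ n := by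
    intro n
    have e : z - τ⁻¹ ^ n * u n = τ⁻¹ ^ n * (τ ^ n * z - u n) := by
      have := h.ne_zero
      rw [inv_pow]
      field_simp
    rw [e, norm_mul, norm_pow, norm_inv, mul_comm]
    gcongr
    exact hzu n
  have hlim : Filter.Tendsto (fun n => τ⁻¹ ^ n * u n) Filter.atTop (nhds z) := by
    rw [tendsto_iff_norm_sub_tendsto_zero]
    refine squeeze_zero (g := fun n => (1 + ‖τ‖) * ‖τ‖⁻¹ ^ n) (fun _ => norm_nonneg _)
      (fun n => by rw [norm_sub_rev]; exact hdist n) ?_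
    simpa using (tendsto_pow_atTop_nhds_zero_of_lt_one (by positivity)
      (inv_lt_one_of_one_lt₀ h.one_lt_norm)).const_mul (1 + ‖τ‖)
  obtain ⟨ρ, hρ⟩ := (h.isCompact_fundamentalDomain (w := w) hVr).isBounded.exists_norm_le
  have htile : ∀ x y, y ∈ tile τ w Vr x → ‖x‖ ≤ ‖y‖ + ρ := by
    rintro x _ ⟨f, hf, rfl⟩
    have h1 : ‖τ⁻¹ ^ divisionDepth τ (w - 1) x * f‖ ≤ ρ := by
      rw [norm_mul, norm_pow, norm_inv]
      exact (mul_le_of_le_one_left (norm_nonneg f) (pow_le_one₀ (by positivity)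
        (inv_le_one_of_one_le₀ h.one_lt_norm.le))).trans (hρ f hf)
    have h2 := norm_sub_le (x + τ⁻¹ ^ divisionDepth τ (w - 1) x * f)
      (τ⁻¹ ^ divisionDepth τ (w - 1) x * f)
    rw [add_sub_cancel_right] at h2
    exact h2.trans (by gcongr)
  have hfin := h.finite_lattice_norm_le (‖z‖ + (1 + ‖τ‖) + ρ)
  have hclosed : IsClosed (⋃ x ∈ {x | x ∈ lattice τ ∧ ‖x‖ ≤ ‖z‖ + (1 + ‖τ‖) + ρ},
      tile τ w Vr x) :=
    hfin.isClosed_biUnion fun x _ => (h.isCompact_tile hVr x).isClosed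
  have hmem := hclosed.mem_of_tendsto hlim (Filter.Eventually.of_forall fun n => by
    obtain ⟨x, hx, hux⟩ := hdivide n (u n) (hu n)
    simp only [Set.mem_iUnion]
    refine ⟨x, ⟨hx, (htile x _ hux).trans ?_⟩, hux⟩
    gcongr
    have h1 := norm_sub_le z (z - τ⁻¹ ^ n * u n)
    rw [sub_sub_cancel] at h1
    refine h1.trans (by
      gcongr
      exact (hdist n).trans (mul_le_of_le_one_right (by positivity) (pow_le_one₀ (by positivity)
        (inv_le_one_of_one_le₀ h.one_lt_norm.le)))))
  simp only [Set.mem_iUnion] at hmem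
  obtain ⟨x, ⟨hx, -⟩, hzx⟩ := hmem
  exact ⟨x, hx, hzx⟩

/-! ### The measures -/

theorem volume_fundamentalDomain (h : IsImaginaryQuadraticBase τ p q)
    (hVr : IsRestrictedVoronoiCell τ Vr) (hw : 2 ≤ w) :
    volume (fundamentalDomain τ w Vr) =
      ENNReal.ofReal (‖τ‖ ^ (2 * w) * |τ.im| / ((‖τ‖ ^ 2 - 1) * w + 1)) := by
  have hw0 : w ≠ 0 := by omega
  have hd : ‖τ‖ ≠ 0 := norm_ne_zero_iff.2 h.ne_zero
  have hd1 : 1 ≤ ‖τ‖ ^ 2 := one_le_pow₀ h.one_lt_norm.le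
  have hden : 0 < (‖τ‖ ^ 2 - 1) * w + 1 := by
    have : 0 ≤ (‖τ‖ ^ 2 - 1) * w := mul_nonneg (by linarith) (by positivity)
    linarith
  have key := h.sum_volume_residues hVr (w - 1) (tile τ w Vr)
    (fun x _ => (h.isCompact_tile hVr x).measurableSet.nullMeasurableSet)
    (fun x _ u hu => tile_add_pow_mul hu)
    (fun x hx y hy hxy => h.aedisjoint_tile hVr hw hx hy hxy)
    (h.exists_mem_tile hVr hw0)
  have hfin : volume (fundamentalDomain τ w Vr) ≠ ∞ :=
    (h.isCompact_fundamentalDomain hVr).measure_ne_top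
  rw [← ENNReal.ofReal_toReal hfin]
  set f := (volume (fundamentalDomain τ w Vr)).toReal with hf
  have hvol : ∀ r, volume (tile τ w Vr r) =
      ENNReal.ofReal (((‖τ‖ ^ 2)⁻¹) ^ divisionDepth τ (w - 1) r * f) := by
    intro r
    rw [tile, volume_similarCopy, ← ENNReal.ofReal_toReal hfin, ← hf,
      ← ENNReal.ofReal_mul (by positivity)]
    congr 2
    rw [norm_pow, norm_inv, inv_pow, inv_pow, inv_pow, ← pow_mul, ← pow_mul, mul_comm]
  have hf0 : 0 ≤ f := ENNReal.toReal_nonneg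
  rw [Finset.sum_congr rfl fun r _ => hvol r,
    ← ENNReal.ofReal_sum_of_nonneg (fun r _ => by positivity), ← Finset.sum_mul,
    h.sum_inv_pow_divisionDepth hVr, h.volume_voronoiCell hVr,
    ← ENNReal.ofReal_pow (by positivity), ← ENNReal.ofReal_mul (by positivity),
    ENNReal.ofReal_eq_ofReal_iff _ (by positivity)] at key
  · congr 1
    obtain ⟨n, rfl⟩ : ∃ n, w = n + 1 := ⟨w - 1, by omega⟩
    rw [Nat.add_sub_cancel] at key
    rw [eq_div_iff hden.ne']
    have e : (1 + n * (1 - (‖τ‖ ^ 2)⁻¹)) * ‖τ‖ ^ 2 = (‖τ‖ ^ 2 - 1) * ((n + 1 : ℕ) : ℝ) + 1 := by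
      push_cast
      field_simp
      ring
    rw [← e, pow_mul, pow_succ]
    linear_combination ‖τ‖ ^ 2 * key
  · have : (‖τ‖ ^ 2)⁻¹ ≤ 1 := inv_le_one_of_one_le₀ hd1
    have : 0 ≤ 1 - (‖τ‖ ^ 2)⁻¹ := by linarith
    positivity

theorem volume_characteristicSet (h : IsImaginaryQuadraticBase τ p q)
    (hVr : IsRestrictedVoronoiCell τ Vr) (hw : 2 ≤ w) {η : ℂ} (hη : η ∈ digitSet τ w Vr)
    (hη0 : η ≠ 0) :
    volume (characteristicSet τ w Vr η) =
      ENNReal.ofReal (digitDensity τ w) * volume (voronoiCell τ) := by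
  have hw0 : w ≠ 0 := by omega
  have hτ0 := h.ne_zero
  have hd : ‖τ‖ ≠ 0 := norm_ne_zero_iff.2 h.ne_zero
  have hd1 : 1 ≤ ‖τ‖ ^ 2 := one_le_pow₀ h.one_lt_norm.le
  have hden : 0 < (‖τ‖ ^ 2 - 1) * w + 1 := by
    have : 0 ≤ (‖τ‖ ^ 2 - 1) * w := mul_nonneg (by linarith) (by positivity)
    linarith
  obtain ⟨hηL, hηdiv⟩ := not_dvd_of_mem_digitSet hη hη0
  have hD := h.finite_digitSet hVr w
  have hA : digitValues τ w Vr η =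
      similarCopy (τ⁻¹ ^ w * η) (τ⁻¹ ^ (w - 1) * τ⁻¹ ^ w) (fundamentalDomain τ w Vr) :=
    image_value_digit_eq h.one_lt_norm hD zero_mem_digitSet hη hη0 hw0
  -- The translates of the set of values are the tiles of the points `η + τ ^ w u`, scaled down.
  have htrans : ∀ u ∈ lattice τ, u +ᵥ digitValues τ w Vr η =
      similarCopy 0 (τ⁻¹ ^ w) (tile τ w Vr (η + τ ^ w * u)) := by
    intro u hu
    have hdepth : divisionDepth τ (w - 1) (η + τ ^ w * u) = w - 1 := by
      have e : η + τ ^ w * u = η + τ ^ (w - 1) * (τ * u) := by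
        rw [← mul_assoc, pow_sub_one_mul hw0]
      rw [e, divisionDepth_add_pow_mul (mul_mem_lattice self_mem_lattice hu),
        h.divisionDepth_of_not_dvd hηL hηdiv]
    rw [hA, tile, hdepth, similarCopy_similarCopy, ← Set.image_vadd]
    unfold similarCopy
    rw [Set.image_image]
    congr 1
    ext z
    rw [vadd_eq_add, inv_pow, inv_pow]
    field_simp
    ring
  rw [characteristicSet, h.volume_fracPartImage hVr, hA, volume_similarCopy,
    h.volume_fundamentalDomain hVr hw, h.volume_voronoiCell hVr,
    ← ENNReal.ofReal_mul (by positivity), ← ENNReal.ofReal_mul (by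
      unfold digitDensity; positivity)]
  · congr 1
    rw [digitDensity]
    obtain ⟨n, rfl⟩ : ∃ n, w = n + 1 := ⟨w - 1, by omega⟩
    rw [norm_mul, norm_pow, norm_pow, norm_inv, inv_pow, inv_pow, Nat.add_sub_cancel]
    field_simp
    ring
  · rw [hA]
    exact (isCompact_similarCopy
      (h.isCompact_fundamentalDomain hVr)).measurableSet.nullMeasurableSet
  · intro u hu v hv huv
    rw [htrans u hu, htrans v hv]
    refine aedisjoint_similarCopy (pow_ne_zero w (inv_ne_zero hτ0)) (h.aedisjoint_tile hVr hw
      (add_mem_lattice hηL (pow_mul_mem_lattice w hu))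
      (add_mem_lattice hηL (pow_mul_mem_lattice w hv)) fun heq => huv ?_)
    exact mul_left_cancel₀ (pow_ne_zero w hτ0) (add_left_cancel heq)

end IsImaginaryQuadraticBase

end Tiling

end WNAF

theorem mainTheorem8 (τ : ℂ) (p q : ℤ)
    (hτ : τ ^ 2 - (p : ℂ) * τ + (q : ℂ) = 0) (hpq : 0 < 4 * q - p ^ 2)
    (hτ1 : 1 < ‖τ‖) (w : ℕ) (hw : 2 ≤ w)
    (Vr : Set ℂ) (hVr : WNAF.IsRestrictedVoronoiCell τ Vr) :
    (∀ η ∈ WNAF.digitSet τ w Vr, η ≠ 0 →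
      volume (WNAF.characteristicSet τ w Vr η) =
        ENNReal.ofReal (WNAF.digitDensity τ w) * volume (WNAF.voronoiCell τ)) ∧
    volume (WNAF.fundamentalDomain τ w Vr) =
      ENNReal.ofReal (‖τ‖ ^ (2 * (2 * w - 1)) * WNAF.digitDensity τ w) *
        volume (WNAF.voronoiCell τ) ∧
    volume (WNAF.fundamentalDomain τ w Vr) =
      ENNReal.ofReal (‖τ‖ ^ (2 * w) * |τ.im| / ((‖τ‖ ^ 2 - 1) * (w : ℝ) + 1)) := by
  have h : WNAF.IsImaginaryQuadraticBase τ p q := ⟨hτ, hpq, hτ1⟩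
  refine ⟨fun η hη hη0 => h.volume_characteristicSet hVr hw hη hη0, ?_,
    h.volume_fundamentalDomain hVr hw⟩
  have hd : ‖τ‖ ≠ 0 := norm_ne_zero_iff.2 h.ne_zero
  have hd1 : 1 ≤ ‖τ‖ ^ 2 := one_le_pow₀ hτ1.le
  have hden : 0 < (‖τ‖ ^ 2 - 1) * w + 1 := by
    have : 0 ≤ (‖τ‖ ^ 2 - 1) * w := mul_nonneg (by linarith) (by positivity)
    linarith
  rw [h.volume_fundamentalDomain hVr hw, h.volume_voronoiCell hVr,
    ← ENNReal.ofReal_mul (by unfold WNAF.digitDensity; positivity)]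
  congr 1
  rw [WNAF.digitDensity]
  obtain ⟨n, rfl⟩ : ∃ n, w = n + 1 := ⟨w - 1, by omega⟩
  rw [show 2 * (n + 1) - 1 = (n + 1) + n by omega, Nat.add_sub_cancel]
  field_simp
  ring
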